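/- Let $X\subseteq\mathbb{R}^n$ be closed and convex, let $\xi$ be a random variable on a probability space with values in a measurable space $\Xi$, let $T:\Xi\times\mathbb{R}^n\to\mathbb{R}^n$ be measurable, and put $H(x):=\mathbb{E}[T(\xi,x)]$. Let $P_X$ denote the Euclidean projection onto $X$ and let $r_t(x):=\|P_X(x-tH(x))-x\|$. Assume that: (0) there is $x^*\in X$ with $\langle H(x^*),x-x^*\rangle\ge 0$ for all $x\in X$; (1) $H$ is pseudomonotone on $X$: for all $x,y\in X$, $\langle H(x),y-x\rangle\ge0$ implies $\langle H(y),y-x\rangle\ge0$; (2) there are a measurable $L:\Xi\to\mathbb{R}$ and a real $p\ge2$ such that, with probability $1$, $L(\xi)\ge1$ and $\|T(\xi,x)-T(\xi,y)\|\le L(\xi)\|x-y\|$ for all $x,y\in\mathbb{R}^n$, and $\mathbb{E}[L(\xi)^{2p}]<\infty$; and there are $\check x\in\mathbb{R}^n$ and a real $q\ge2$ with $\mathbb{E}[\|T(\xi,\check x)\|^{2q}]<\infty$; (3) $S_k\ge1$ $(k\ge 0)$ are integers with $\sum_{k=0}^\infty 1/\sqrt{S_k}<\infty$, and $\xi^k_j,\eta^k_j$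 $(k\ge0,\ 1\le j\le S_k)$ are mutually independent random variables, each distributed as $\xi$. Let $\nu\ge0$, $\gamma\in(0,1]$, $\rho\in(0,1)$, $\mu\in(0,\sqrt3/3)$, $\tau>1/2$, $M>0$, and write $H_{\xi^k}(x)=\frac1{S_k}\sum_{j=1}^{S_k}T(\xi^k_j,x)$ and $H_{\eta^k}(x)=\frac1{S_k}\sum_{j=1}^{S_k}T(\eta^k_j,x)$. Let $x_0$ be an initial point in $X$, deterministic or, more generally, random, square integrable and independent of all the samples, and let $\theta_0=1$. The Anderson(1)-SEG algorithm generates $(x_k,\theta_k)$ as follows, for $k=0,1,2,\dots$: * If $P_X(x_k-\gamma H_{\xi^k}(x_k))=x_k$, set $x_{k+1}=x_k$, $\theta_{k+1}=\theta_k$. * Otherwise let $t_k=\gamma\rho^{m}$ with the smallest integer $m\ge0$ for which $y_{k+0.5}:=P_X(x_k-t_kH_{\xi^k}(x_k))$ satisfies $t_k\|H_{\xi^k}(x_k)-H_{\xi^k}(y_{k+0.5})\|\le\mu\|x_k-y_{k+0.5}\|$ (such an $m$ exists almost surely). Put $F_k=y_{k+0.5}-x_k$, $y_{k+1}=P_X(x_k-t_kH_{\eta^k}(y_{k+0.5}))$,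 $\tilde F_k=y_{k+1}-x_k$. If $\|\tilde F_k\|<\min\{\|F_k\|,\nu\theta_k^{-\tau}\}$, set $\alpha_k=\langle\tilde F_k,\tilde F_k-F_k\rangle/\|\tilde F_k-F_k\|^2$; otherwise set $\alpha_k=M+1$. If $|\alpha_k|\le M$, set $x_{k+1}=\alpha_kx_k+(1-\alpha_k)y_{k+1}$, $\theta_{k+1}=\theta_k+1$; otherwise set $x_{k+1}=y_{k+1}$, $\theta_{k+1}=\theta_k$. Then $\mathbb{E}[r_\gamma(x_k)^2]<\infty$ for every $k$, and $$\min_{0\le k\le N}\mathbb{E}\left[r_\gamma(x_k)^2\right]=\mathcal{O}\left(\frac1N\right),$$ that is, there is a constant $C>0$ such that the left-hand side is at most $C/N$ for every integer $N\ge1$. -/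

import Mathlib

open MeasureTheory ProbabilityTheory

noncomputable section

namespace AndersonSEG

/-- The Euclidean space `ℝⁿ`. -/
abbrev Rn (n : ℕ) : Type := EuclideanSpace ℝ (Fin n)

/-- The Euclidean projection `P_X(x) = argmin_{y ∈ X} ‖y - x‖`; for a nonempty closed convex set `X`
the minimizer exists (`proj_spec`) and is unique (`proj_unique`). -/
def proj {n : ℕ} (X : Set (Rn n)) (x : Rn n) : Rn n :=
  Classical.epsilon fun y => y ∈ X ∧ ∀ z ∈ X, ‖y - x‖ ≤ ‖z - x‖

theorem proj_spec {n : ℕ} {X : Set (Rn n)} (hne : X.Nonempty) (hcl : IsClosed X)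
    (x : Rn n) : proj X x ∈ X ∧ ∀ z ∈ X, ‖proj X x - x‖ ≤ ‖z - x‖ := by
  refine Classical.epsilon_spec (p := fun y => y ∈ X ∧ ∀ z ∈ X, ‖y - x‖ ≤ ‖z - x‖) ?_
  obtain ⟨y, hy, hxy⟩ := hcl.exists_infDist_eq_dist hne x
  refine ⟨y, hy, fun z hz => ?_⟩
  have h := Metric.infDist_le_dist_of_mem (x := x) hz
  rw [hxy, dist_comm, dist_comm x z, dist_eq_norm, dist_eq_norm] at h
  exact h

theorem proj_unique {n : ℕ} {X : Set (Rn n)} (hcl : IsClosed X) (hcv : Convex ℝ X)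
    (x y : Rn n) (hy : y ∈ X) (hmin : ∀ z ∈ X, ‖y - x‖ ≤ ‖z - x‖) : proj X x = y := by
  obtain ⟨hp, hpmin⟩ := proj_spec ⟨y, hy⟩ hcl x
  have key : ∀ v ∈ X, (∀ z ∈ X, ‖v - x‖ ≤ ‖z - x‖) → ∀ w ∈ X, inner ℝ (x - v) (w - v) ≤ 0 := by
    intro v hv hvmin
    refine (norm_eq_iInf_iff_real_inner_le_zero hcv hv).1 ?_
    have : Nonempty X := ⟨⟨v, hv⟩⟩
    refine le_antisymm (le_ciInf fun z => ?_) (ciInf_le (f := fun w : X => ‖x - w‖) ?_ ⟨v, hv⟩)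
    · rw [norm_sub_rev x v, norm_sub_rev x z]
      exact hvmin z z.2
    · exact ⟨0, by rintro _ ⟨z, rfl⟩; exact norm_nonneg _⟩
  have h1 := key _ hp hpmin y hy
  have h2 := key y hy hmin _ hp
  have h3 : inner ℝ (proj X x - y) (proj X x - y) ≤ (0 : ℝ) := by
    have e : inner ℝ (proj X x - y) (proj X x - y)
        = inner ℝ (x - proj X x) (y - proj X x) + inner ℝ (x - y) (proj X x - y) := by
      simp only [inner_sub_left, inner_sub_right]
      ring
    rw [e]
    linarith
  rw [real_inner_self_eq_norm_sq] at h3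
  have h4 : ‖proj X x - y‖ = 0 := by nlinarith [norm_nonneg (proj X x - y)]
  exact sub_eq_zero.1 (norm_eq_zero.1 h4)

/-- The solution set `SOL(X, H)` of the variational inequality. -/
def SOL {n : ℕ} (X : Set (Rn n)) (H : Rn n → Rn n) : Set (Rn n) :=
  {z | z ∈ X ∧ ∀ x ∈ X, 0 ≤ inner ℝ (H z) (x - z)}

/-- `H` is pseudomonotone on `X`. -/
def PseudomonotoneOn {n : ℕ} (H : Rn n → Rn n) (X : Set (Rn n)) : Prop :=
  ∀ x ∈ X, ∀ y ∈ X, 0 ≤ inner ℝ (H x) (y - x) → 0 ≤ inner ℝ (H y) (y - x)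

/-- The residual function `r_t(x) = ‖P_X(x - t H(x)) - x‖`. -/
def residual {n : ℕ} (X : Set (Rn n)) (H : Rn n → Rn n) (t : ℝ) (x : Rn n) : ℝ :=
  ‖proj X (x - t • H x) - x‖

/-- The mean operator `H(x) = 𝔼[T(ξ, x)]`. -/
def meanOp {n : ℕ} {Ω Ξ : Type*} [MeasurableSpace Ω] (P : Measure Ω) (ξ : Ω → Ξ)
    (T : Ξ → Rn n → Rn n) (x : Rn n) : Rn n :=
  ∫ ω, T (ξ ω) x ∂P

/-- The empirical operator `x ↦ (1/m) ∑ⱼ T(sⱼ, x)` of a sample `s₁, …, sₘ`. -/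
def empOp {n m : ℕ} {Ξ : Type*} (T : Ξ → Rn n → Rn n) (s : Fin m → Ξ) (x : Rn n) : Rn n :=
  (m : ℝ)⁻¹ • ∑ j, T (s j) x

/-- The parameters of the Anderson(1)-SEG algorithm and their admissible ranges. -/
structure Params where
  ν : ℝ
  γ : ℝ
  ρ : ℝ
  μ : ℝ
  τ : ℝ
  M : ℝ
  ν_nonneg : 0 ≤ ν
  γ_pos : 0 < γ
  γ_le_one : γ ≤ 1
  ρ_pos : 0 < ρ
  ρ_lt_one : ρ < 1
  μ_pos : 0 < μ
  μ_lt : μ < √3 / 3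
  τ_gt : 1 / 2 < τ
  M_pos : 0 < M

/-- The line search test at the point `x` for the operator `G` and the trial step `t`. -/
def LineSearchTest {n : ℕ} (X : Set (Rn n)) (μ : ℝ) (G : Rn n → Rn n) (x : Rn n) (t : ℝ) : Prop :=
  t * ‖G x - G (proj X (x - t • G x))‖ ≤ μ * ‖x - proj X (x - t • G x)‖

/-- The step size `γ ρ^m` accepted by the line search, `m` being the first number of reductions for
which the test holds. The search terminates for Lipschitz `G` (`lineSearch_terminates`). -/
def stepSize {n : ℕ} (X : Set (Rn n)) (p : Params) (G : Rn n → Rn n) (x : Rn n) : ℝ :=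
  p.γ * p.ρ ^ sInf {m : ℕ | LineSearchTest X p.μ G x (p.γ * p.ρ ^ m)}

theorem lineSearch_terminates {n : ℕ} (X : Set (Rn n)) (p : Params) (G : Rn n → Rn n)
    (L : ℝ) (hL : 0 < L) (hG : ∀ x y, ‖G x - G y‖ ≤ L * ‖x - y‖) (x : Rn n) :
    ∃ m : ℕ, LineSearchTest X p.μ G x (p.γ * p.ρ ^ m) := by
  have hγ := p.γ_pos
  obtain ⟨m, hm⟩ := exists_pow_lt_of_lt_one
    (div_pos p.μ_pos (mul_pos hγ hL)) p.ρ_lt_one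
  refine ⟨m, ?_⟩
  unfold LineSearchTest
  have ht : 0 ≤ p.γ * p.ρ ^ m := mul_nonneg hγ.le (pow_nonneg p.ρ_pos.le m)
  rw [lt_div_iff₀ (mul_pos hγ hL)] at hm
  calc _ ≤ p.γ * p.ρ ^ m * (L * ‖x - proj X (x - (p.γ * p.ρ ^ m) • G x)‖) :=
        mul_le_mul_of_nonneg_left (hG _ _) ht
    _ = (p.ρ ^ m * (p.γ * L)) * ‖x - proj X (x - (p.γ * p.ρ ^ m) • G x)‖ := by ring
    _ ≤ _ := mul_le_mul_of_nonneg_right hm.le (norm_nonneg _)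

open Classical in
/-- One iteration of the Anderson(1)-SEG algorithm, with `G` and `K` the empirical operators of the
two samples of this iteration, and `s = (x_k, θ_k)` the current state. Here `y` is `y_{k+0.5}`,
`z` is `y_{k+1}`, `F` is `F_{t_k, ξ^k}` and `F'` is `F̃_{t_k, η^k}`. -/
def step {n : ℕ} (X : Set (Rn n)) (p : Params) (G K : Rn n → Rn n) (s : Rn n × ℕ) : Rn n × ℕ :=
  let x := s.1
  let θ := s.2
  if proj X (x - p.γ • G x) - x = 0 then (x, θ)
  else
    let t := stepSize X p G x
    let y := proj X (x - t • G x)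
    let F := y - x
    let z := proj X (x - t • K y)
    let F' := z - x
    let α : ℝ :=
      if ‖F'‖ < min ‖F‖ (p.ν * (θ : ℝ) ^ (-p.τ)) then inner ℝ F' (F' - F) / ‖F' - F‖ ^ 2
      else p.M + 1
    if |α| ≤ p.M then (α • x + (1 - α) • z, θ + 1) else (z, θ)

/-- The states `(x_k, θ_k)` generated by the Anderson(1)-SEG algorithm from the initial point `x₀`
(with `θ₀ = 1`) and the realized samples `a k = (ξ^k_j)_j`, `b k = (η^k_j)_j` of size `S k`. -/
def state {n : ℕ} {Ξ : Type*} (X : Set (Rn n)) (p : Params) (T : Ξ → Rn n → Rn n) (S : ℕ → ℕ)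
    (x₀ : Rn n) (a b : (k : ℕ) → Fin (S k) → Ξ) : ℕ → Rn n × ℕ
  | 0 => (x₀, 1)
  | k + 1 => step X p (empOp T (a k)) (empOp T (b k)) (state X p T S x₀ a b k)

/-- The random iterate `x_k` of the Anderson(1)-SEG algorithm. -/
def iterate {n : ℕ} {Ω Ξ : Type*} (X : Set (Rn n)) (p : Params) (T : Ξ → Rn n → Rn n) (S : ℕ → ℕ)
    (x₀ : Ω → Rn n) (ξs ηs : (k : ℕ) → Fin (S k) → Ω → Ξ) (k : ℕ) (ω : Ω) : Rn n :=
  (state X p T S (x₀ ω) (fun i j => ξs i j ω) (fun i j => ηs i j ω) k).1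

/-- Lipschitz continuity of `T(ξ, ·)` with a random modulus `L(ξ) ≥ 1` that has a finite moment of
some order `2p ≥ 4`, and a finite moment of some order `2q ≥ 4` of `T(ξ, ·)` at some point.
The almost sure statements are with respect to the law of `ξ`, so that they pass to its samples. -/
structure OracleAssumption {n : ℕ} {Ω Ξ : Type*} [MeasurableSpace Ω] [MeasurableSpace Ξ]
    (P : Measure Ω) (ξ : Ω → Ξ) (T : Ξ → Rn n → Rn n) : Prop where
  lipschitz : ∃ L : Ξ → ℝ, Measurable L ∧
    (∀ᵐ s ∂(P.map ξ), 1 ≤ L s) ∧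
    (∀ᵐ s ∂(P.map ξ), ∀ x y : Rn n, ‖T s x - T s y‖ ≤ L s * ‖x - y‖) ∧
    ∃ p : ℝ, 2 ≤ p ∧ Integrable (fun ω => L (ξ ω) ^ (2 * p)) P
  moment : ∃ (x : Rn n) (q : ℝ), 2 ≤ q ∧ Integrable (fun ω => ‖T (ξ ω) x‖ ^ (2 * q)) P

/-- The samples `ξ^k_j` and `η^k_j` (`k ∈ ℕ`, `1 ≤ j ≤ S_k`) are random variables distributed as `ξ`
which are all mutually independent. -/
structure IsSampling {Ω Ξ : Type*} [MeasurableSpace Ω] [MeasurableSpace Ξ]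
    (P : Measure Ω) (ξ : Ω → Ξ) (S : ℕ → ℕ) (ξs ηs : (k : ℕ) → Fin (S k) → Ω → Ξ) : Prop where
  measurable_ξs : ∀ k j, Measurable (ξs k j)
  measurable_ηs : ∀ k j, Measurable (ηs k j)
  identDistrib_ξs : ∀ k j, IdentDistrib (ξs k j) ξ P P
  identDistrib_ηs : ∀ k j, IdentDistrib (ηs k j) ξ P P
  indep : iIndepFun (fun i : (Σ k, Fin (S k)) ⊕ (Σ k, Fin (S k)) =>
    Sum.elim (fun a => ξs a.1 a.2) (fun a => ηs a.1 a.2) i) P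

end AndersonSEG

end

/-! Fix a solution `xs`. Pseudomonotonicity gives `⟨H y, y - xs⟩ ≥ 0` for every `y ∈ X`, so an
extragradient step whose line search test holds with `μ² ≤ 1/3` decreases `‖x - xs‖²` by `‖x - y‖² /
3`, up to sampling errors at the half step `y` (`extragradient_le`).

An accepted Anderson coefficient lies in `[-M, 1/2]`. Hence at least half of the decrease survives
the combination, while the extrapolation costs at most `M (M + 1) (ν θ^(-τ))²`. The counter grows
with every accepted combination and `2τ > 1`, so these costs are summable, and adding their tail sum
`potential` to the squared distance absorbs them (`step_energy_le`).

The sampling errors need care because `y` and the step size depend on the first sample. Compare the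
empirical Lipschitz constant `ℓ` with its mean `l`. If `ℓ ≤ 2l`, the step size takes finitely many
values and `y` is close to one of finitely many points that depend on `x` only. If `ℓ > 2l`, then
`(ℓ - l)² ≥ 1`, and this deviation pays for a crude bound. The same dichotomy relates the sampled
step to the residual of `H` (`stepSize_sq_mul_error_sq_le`, `residual_sq_le_sampled`).

The second sample is independent of `y`, but the Anderson coefficient depends on it, so the cross
term `⟨K y - H y, xs - y⟩` cannot be dropped for having conditional mean zero. Young's inequality
with weight `√S_k` balances it: an error variance of order `1 / S_k` yields a contribution of order
`1 / √S_k`, which is where the summability assumption comes from.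

All second moments grow at most like `1 + ‖x - xs‖²`, which is why `energy` contains the summand
`1`. With `V_k` the energy of the `k`-th state, the outcome is `𝔼 V_{k+1} + c 𝔼 r² ≤ (1 + C / √S_k)
𝔼 V_k` (`exists_lintegral_energy_step_le` and independence). A Gronwall argument bounds the sum of
all `𝔼 r²`, and the minimum is at most the average. -/

noncomputable section

namespace AndersonSEG

/-! ### Euclidean projections -/

theorem inner_sub_proj_nonpos {n : ℕ} {X : Set (Rn n)} (hcl : IsClosed X) (hcv : Convex ℝ X)
    (x : Rn n) {w : Rn n} (hw : w ∈ X) : inner ℝ (x - proj X x) (w - proj X x) ≤ 0 := by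
  obtain ⟨hp, hmin⟩ := proj_spec ⟨w, hw⟩ hcl x
  refine (norm_eq_iInf_iff_real_inner_le_zero hcv hp).1 ?_ w hw
  have : Nonempty X := ⟨⟨w, hw⟩⟩
  refine le_antisymm (le_ciInf fun z => ?_) (ciInf_le (f := fun w : X => ‖x - w‖) ?_ ⟨_, hp⟩)
  · rw [norm_sub_rev x, norm_sub_rev x z]
    exact hmin z z.2
  · exact ⟨0, by rintro _ ⟨z, rfl⟩; exact norm_nonneg _⟩

theorem proj_of_mem {n : ℕ} {X : Set (Rn n)} (hcl : IsClosed X) (hcv : Convex ℝ X)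
    {x : Rn n} (hx : x ∈ X) : proj X x = x :=
  proj_unique hcl hcv x x hx fun z _ => by simp

theorem norm_proj_sub_proj_le {n : ℕ} {X : Set (Rn n)} (hne : X.Nonempty) (hcl : IsClosed X)
    (hcv : Convex ℝ X) (x y : Rn n) : ‖proj X x - proj X y‖ ≤ ‖x - y‖ := by
  have h1 := inner_sub_proj_nonpos hcl hcv x (proj_spec hne hcl y).1
  have h2 := inner_sub_proj_nonpos hcl hcv y (proj_spec hne hcl x).1
  have h3 : ‖proj X x - proj X y‖ ^ 2 ≤ inner ℝ (x - y) (proj X x - proj X y) := by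
    rw [← real_inner_self_eq_norm_sq]
    have e : inner ℝ (x - y) (proj X x - proj X y)
        - inner ℝ (proj X x - proj X y) (proj X x - proj X y)
        = - inner ℝ (x - proj X x) (proj X y - proj X x)
          - inner ℝ (y - proj X y) (proj X x - proj X y) := by
      simp only [inner_sub_left, inner_sub_right]
      ring
    linarith
  have h4 := real_inner_le_norm (x - y) (proj X x - proj X y)
  by_contra! h5
  have h6 : 0 < ‖proj X x - proj X y‖ := lt_of_le_of_lt (norm_nonneg _) h5
  nlinarith

theorem norm_proj_sub_le {n : ℕ} {X : Set (Rn n)} (hcl : IsClosed X)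
    (hcv : Convex ℝ X) (x : Rn n) {y : Rn n} (hy : y ∈ X) : ‖proj X x - y‖ ≤ ‖x - y‖ := by
  have := norm_proj_sub_proj_le ⟨y, hy⟩ hcl hcv x y
  rwa [proj_of_mem hcl hcv hy] at this

theorem continuous_proj {n : ℕ} {X : Set (Rn n)} (hne : X.Nonempty) (hcl : IsClosed X)
    (hcv : Convex ℝ X) : Continuous (proj X) := by
  refine (LipschitzWith.of_dist_le_mul (K := 1) fun x y => ?_).continuous
  rw [dist_eq_norm, dist_eq_norm, NNReal.coe_one, one_mul]
  exact norm_proj_sub_proj_le hne hcl hcv x y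

/-- The displacement of a projected step divided by the step size is nonincreasing in the step
size, wherever the step starts. -/
theorem mul_norm_proj_step_le {n : ℕ} {X : Set (Rn n)} (hne : X.Nonempty) (hcl : IsClosed X)
    (hcv : Convex ℝ X) (x g : Rn n) {s t : ℝ} (ht : 0 < t) (hts : t ≤ s) :
    t * ‖proj X (x - s • g) - x‖ ≤ s * ‖proj X (x - t • g) - x‖ := by
  set y := proj X (x - t • g) with hy
  set z := proj X (x - s • g) with hz
  have h1 : inner ℝ (x - t • g - y) (z - y) ≤ 0 :=
    inner_sub_proj_nonpos hcl hcv _ (proj_spec hne hcl _).1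
  have h2 : inner ℝ (x - s • g - z) (y - z) ≤ 0 :=
    inner_sub_proj_nonpos hcl hcv _ (proj_spec hne hcl _).1
  -- Weighting the two variational inequalities by `s` and `t` makes the terms in `g` cancel.
  have h3 : s * ‖y - x‖ ^ 2 + t * ‖z - x‖ ^ 2 ≤ (s + t) * inner ℝ (y - x) (z - x) := by
    have e : s * inner ℝ (y - x) (y - x) + t * inner ℝ (z - x) (z - x)
        - (s + t) * inner ℝ (y - x) (z - x)
        = s * inner ℝ (x - t • g - y) (z - y) + t * inner ℝ (x - s • g - z) (y - z) := by
      simp only [inner_sub_left, inner_sub_right, real_inner_smul_left]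
      rw [real_inner_comm y x, real_inner_comm z x, real_inner_comm z y]
      ring
    rw [← real_inner_self_eq_norm_sq, ← real_inner_self_eq_norm_sq]
    nlinarith
  have h4 := real_inner_le_norm (y - x) (z - x)
  have hy0 := norm_nonneg (y - x)
  have hz0 := norm_nonneg (z - x)
  -- Cauchy–Schwarz makes `h3` factor. If the second factor were negative, so would be the first,
  -- because `t ≤ s`.
  have h5 : (‖y - x‖ - ‖z - x‖) * (s * ‖y - x‖ - t * ‖z - x‖) ≤ 0 := by nlinarith
  by_contra! h6
  have h7 : ‖y - x‖ < ‖z - x‖ := by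
    by_contra! h8
    nlinarith
  nlinarith

/-! ### Deterministic descent of one iteration -/

/-- The basic descent inequality of an extragradient step with two different operators. -/
theorem extragradient_le {n : ℕ} {X : Set (Rn n)} (hcl : IsClosed X) (hcv : Convex ℝ X)
    {x xs g g' k h : Rn n} {t μ : ℝ} (hxs : xs ∈ X) (ht : 0 ≤ t) (hμ : μ ^ 2 ≤ 1 / 3)
    (hline : t * ‖g - g'‖ ≤ μ * ‖x - proj X (x - t • g)‖)
    (hh : 0 ≤ inner ℝ h (proj X (x - t • g) - xs)) :
    ‖proj X (x - t • k) - xs‖ ^ 2 ≤ ‖x - xs‖ ^ 2 - ‖x - proj X (x - t • g)‖ ^ 2 / 3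
      + (2 * t ^ 2 * ‖g' - k‖ ^ 2 + 2 * t * (‖k - h‖ * ‖proj X (x - t • g) - xs‖)) := by
  set y := proj X (x - t • g) with hy
  set z := proj X (x - t • k) with hz
  have h1 : inner ℝ (x - t • g - y) (z - y) ≤ 0 :=
    inner_sub_proj_nonpos hcl hcv _ (proj_spec ⟨xs, hxs⟩ hcl _).1
  have h2 : inner ℝ (x - t • k - z) (xs - z) ≤ 0 := inner_sub_proj_nonpos hcl hcv _ hxs
  have e : ‖z - xs‖ ^ 2 = ‖x - xs‖ ^ 2 - ‖x - y‖ ^ 2 - ‖z - y‖ ^ 2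
      + 2 * inner ℝ (x - t • k - z) (xs - z) + 2 * inner ℝ (x - t • g - y) (z - y)
      + 2 * (t * inner ℝ (g - g') (z - y)) + 2 * (t * inner ℝ (g' - k) (z - y))
      + 2 * t * inner ℝ (k - h) (xs - y) - 2 * t * inner ℝ h (y - xs) := by
    simp only [← real_inner_self_eq_norm_sq, inner_sub_left, inner_sub_right,
      real_inner_smul_left]
    rw [real_inner_comm xs x, real_inner_comm xs z, real_inner_comm y x, real_inner_comm z x,
      real_inner_comm y z]
    ring
  have h3 := mul_le_mul_of_nonneg_left (real_inner_le_norm (g - g') (z - y)) ht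
  have h4 := mul_le_mul_of_nonneg_left (real_inner_le_norm (g' - k) (z - y)) ht
  have h5 := mul_le_mul_of_nonneg_left (real_inner_le_norm (k - h) (xs - y)) ht
  have h6 := mul_nonneg ht hh
  rw [norm_sub_rev xs y] at h5
  have h7 : t * ‖g - g'‖ * ‖z - y‖ ≤ μ * ‖x - y‖ * ‖z - y‖ :=
    mul_le_mul_of_nonneg_right hline (norm_nonneg _)
  have h8 : μ ^ 2 * ‖x - y‖ ^ 2 ≤ 1 / 3 * ‖x - y‖ ^ 2 :=
    mul_le_mul_of_nonneg_right hμ (sq_nonneg _)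
  -- With `a = ‖x - y‖`, `b = ‖z - y‖`, `e = t ‖g' - k‖`: `2b(μa + e) - b² ≤ (μa + e)² ≤ 2μ²a² +
  -- 2e²`, and `2μ² ≤ 2/3` leaves `a² / 3` of the decrease.
  nlinarith [sq_nonneg (‖z - y‖ - μ * ‖x - y‖ - t * ‖g' - k‖),
    sq_nonneg (μ * ‖x - y‖ - t * ‖g' - k‖)]

theorem norm_combination_sub_sq {E : Type*} [NormedAddCommGroup E] [InnerProductSpace ℝ E]
    (α : ℝ) (x z w : E) :
    ‖α • x + (1 - α) • z - w‖ ^ 2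
      = α * ‖x - w‖ ^ 2 + (1 - α) * ‖z - w‖ ^ 2 - α * (1 - α) * ‖z - x‖ ^ 2 := by
  simp only [← real_inner_self_eq_norm_sq, inner_sub_left, inner_sub_right,
    real_inner_smul_left, real_inner_smul_right, inner_add_left, inner_add_right]
  rw [real_inner_comm x z, real_inner_comm w z, real_inner_comm w x]
  ring

/-- Polarization: `2⟨u, u - v⟩ = ‖u - v‖² + ‖u‖² - ‖v‖²`. For the Anderson coefficient this gives `1
- α ≥ 1/2`, so the combination keeps half of the extragradient decrease. -/
theorem inner_sub_div_norm_sq_le_half {E : Type*} [NormedAddCommGroup E] [InnerProductSpace ℝ E]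
    {u v : E} (h : ‖u‖ ≤ ‖v‖) : inner ℝ u (u - v) / ‖u - v‖ ^ 2 ≤ 1 / 2 := by
  rcases eq_or_ne (‖u - v‖) 0 with h0 | h0
  · simp [h0]
  · rw [div_le_iff₀ (by positivity), norm_sub_sq_real, inner_sub_right, real_inner_self_eq_norm_sq]
    nlinarith [norm_nonneg u]

/-- Energy estimate for one iteration, with an arbitrary potential `Φ` of the counter that absorbs
the Anderson corrections. -/
theorem step_energy_le {n : ℕ} {X : Set (Rn n)} (hcl : IsClosed X) (hcv : Convex ℝ X)
    (p : Params) (G K : Rn n → Rn n) (x : Rn n) (θ : ℕ) {xs h : Rn n} (hxs : xs ∈ X) (Φ : ℕ → ℝ)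
    (hΦ : Φ (θ + 1) + p.M * (p.M + 1) * (p.ν * (θ : ℝ) ^ (-p.τ)) ^ 2 ≤ Φ θ)
    (hline : LineSearchTest X p.μ G x (stepSize X p G x))
    (hh : 0 ≤ inner ℝ h (proj X (x - stepSize X p G x • G x) - xs)) :
    ‖(step X p G K (x, θ)).1 - xs‖ ^ 2 + Φ (step X p G K (x, θ)).2
      + (stepSize X p G x / p.γ * ‖proj X (x - p.γ • G x) - x‖) ^ 2 / 6 ≤
    ‖x - xs‖ ^ 2 + Φ θ + (1 + p.M) * (2 * stepSize X p G x ^ 2 *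
        ‖G (proj X (x - stepSize X p G x • G x)) - K (proj X (x - stepSize X p G x • G x))‖ ^ 2
      + 2 * stepSize X p G x * (‖K (proj X (x - stepSize X p G x • G x)) - h‖ *
        ‖proj X (x - stepSize X p G x • G x) - xs‖)) := by
  have hγ := p.γ_pos
  have hM := p.M_pos
  have hρ := p.ρ_pos
  have hμ : p.μ ^ 2 ≤ 1 / 3 := by
    have h3 : (√3 / 3) ^ 2 = (1 : ℝ) / 3 := by
      rw [div_pow, Real.sq_sqrt (by norm_num)]
      norm_num
    rw [← h3]
    exact pow_le_pow_left₀ p.μ_pos.le p.μ_lt.le 2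
  have ht : 0 < stepSize X p G x := mul_pos hγ (pow_pos hρ _)
  have htγ : stepSize X p G x ≤ p.γ :=
    mul_le_of_le_one_right hγ.le (pow_le_one₀ hρ.le p.ρ_lt_one.le)
  have hmono := mul_norm_proj_step_le ⟨xs, hxs⟩ hcl hcv x (G x) ht htγ
  have hdesc := extragradient_le (k := K (proj X (x - stepSize X p G x • G x))) hcl hcv hxs ht.le
    hμ hline hh
  simp only [step]
  generalize stepSize X p G x = t at *
  set y := proj X (x - t • G x) with hy
  set z := proj X (x - t • K y) with hz
  set E := 2 * t ^ 2 * ‖G y - K y‖ ^ 2 + 2 * t * (‖K y - h‖ * ‖y - xs‖) with hEdef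
  have hE0 : 0 ≤ E := by positivity
  split_ifs with h0 h1 h2 h2
  -- No movement: the sampled residual vanishes and the error term is nonnegative.
  · rw [h0]
    simp only [norm_zero, mul_zero]
    nlinarith [mul_nonneg (by linarith : 0 ≤ 1 + p.M) hE0]
  all_goals
    have hres : t / p.γ * ‖proj X (x - p.γ • G x) - x‖ ≤ ‖x - y‖ := by
      rw [div_mul_eq_mul_div, div_le_iff₀ hγ, norm_sub_rev x y]
      linarith
    have hres2 := pow_le_pow_left₀ (by positivity) hres 2
    have hd0 := sq_nonneg (‖x - y‖)
  · obtain ⟨h3, h4⟩ := lt_min_iff.1 h1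
    have hα := inner_sub_div_norm_sq_le_half h3.le
    generalize inner ℝ (z - x) (z - x - (y - x)) / ‖z - x - (y - x)‖ ^ 2 = α at *
    rw [norm_combination_sub_sq]
    have h5 := pow_le_pow_left₀ (norm_nonneg _) h4.le 2
    have h6 := (abs_le.1 h2).1
    -- The left factor is nonpositive for `α ∈ [0, 1/2]` and at most `M (M + 1)` for `α ∈ [-M, 0]`.
    have h7 : -(α * (1 - α)) * ‖z - x‖ ^ 2 ≤ p.M * (p.M + 1) * ‖z - x‖ ^ 2 := by
      refine mul_le_mul_of_nonneg_right ?_ (sq_nonneg _)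
      nlinarith
    have h8 := mul_le_mul_of_nonneg_left h5 (by positivity : 0 ≤ p.M * (p.M + 1))
    have h9 : (1 - α) * ‖z - xs‖ ^ 2 ≤ (1 - α) * (‖x - xs‖ ^ 2 - ‖x - y‖ ^ 2 / 3 + E) :=
      mul_le_mul_of_nonneg_left hdesc (by linarith)
    have h10 : (1 - α) * E ≤ (1 + p.M) * E := mul_le_mul_of_nonneg_right (by linarith) hE0
    have h11 : 1 / 2 * ‖x - y‖ ^ 2 ≤ (1 - α) * ‖x - y‖ ^ 2 :=
      mul_le_mul_of_nonneg_right (by linarith) hd0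
    nlinarith
  · nlinarith
  -- The default value `M + 1` can never pass the test `|α| ≤ M`.
  · rw [abs_of_pos (by linarith)] at h2
    linarith
  · nlinarith

/-! ### The potential of the Anderson counter -/

/-- The tail sum that absorbs all remaining Anderson corrections. -/
def potential (p : Params) (θ : ℕ) : ℝ :=
  ∑' j : ℕ, p.M * (p.M + 1) * (p.ν * ((j + θ : ℕ) : ℝ) ^ (-p.τ)) ^ 2

theorem summable_potential (p : Params) :
    Summable fun j : ℕ => p.M * (p.M + 1) * (p.ν * (j : ℝ) ^ (-p.τ)) ^ 2 := by
  refine Summable.mul_left _ ?_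
  simp only [mul_pow]
  refine Summable.mul_left _ ?_
  have h : ∀ j : ℕ, ((j : ℝ) ^ (-p.τ)) ^ 2 = (j : ℝ) ^ (-(2 * p.τ)) := by
    intro j
    rw [← Real.rpow_natCast, ← Real.rpow_mul (Nat.cast_nonneg j)]
    congr 1
    push_cast
    ring
  simp only [h]
  rw [Real.summable_nat_rpow]
  linarith [p.τ_gt]

theorem potential_succ (p : Params) (θ : ℕ) :
    potential p (θ + 1) + p.M * (p.M + 1) * (p.ν * (θ : ℝ) ^ (-p.τ)) ^ 2 = potential p θ := by
  have h := ((summable_nat_add_iff θ).2 (summable_potential p)).tsum_eq_zero_add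
  unfold potential
  rw [h, add_comm]
  congr 1
  · simp
  · refine tsum_congr fun j => ?_
    rw [add_right_comm, add_assoc]

theorem potential_nonneg (p : Params) (θ : ℕ) : 0 ≤ potential p θ := by
  have := p.M_pos
  exact tsum_nonneg fun j => by positivity

/-! ### Bounds on the line search step -/

theorem stepSize_pos {n : ℕ} (X : Set (Rn n)) (p : Params) (G : Rn n → Rn n) (x : Rn n) :
    0 < stepSize X p G x :=
  mul_pos p.γ_pos (pow_pos p.ρ_pos _)

theorem stepSize_le_one {n : ℕ} (X : Set (Rn n)) (p : Params) (G : Rn n → Rn n) (x : Rn n) :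
    stepSize X p G x ≤ 1 :=
  mul_le_one₀ p.γ_le_one (pow_nonneg p.ρ_pos.le _) (pow_le_one₀ p.ρ_pos.le p.ρ_lt_one.le)

theorem lineSearchTest_stepSize {n : ℕ} (X : Set (Rn n)) (p : Params) (G : Rn n → Rn n)
    {ℓ : ℝ} (hℓ : 0 < ℓ) (hG : ∀ x y, ‖G x - G y‖ ≤ ℓ * ‖x - y‖) (x : Rn n) :
    LineSearchTest X p.μ G x (stepSize X p G x) :=
  Nat.sInf_mem (s := {m : ℕ | LineSearchTest X p.μ G x (p.γ * p.ρ ^ m)})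
    (lineSearch_terminates X p G ℓ hℓ hG x)

/-- A bound on the Lipschitz constant bounds the number of reductions of the line search. -/
theorem exists_stepSize_eq {n : ℕ} (X : Set (Rn n)) (p : Params) (G : Rn n → Rn n)
    {ℓ : ℝ} (hG : ∀ x y, ‖G x - G y‖ ≤ ℓ * ‖x - y‖) (x : Rn n) {m₀ : ℕ}
    (hm₀ : p.γ * p.ρ ^ m₀ * ℓ ≤ p.μ) :
    ∃ m ≤ m₀, stepSize X p G x = p.γ * p.ρ ^ m := by
  refine ⟨_, Nat.sInf_le ?_, rfl⟩
  change LineSearchTest X p.μ G x (p.γ * p.ρ ^ m₀)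
  unfold LineSearchTest
  have ht : 0 ≤ p.γ * p.ρ ^ m₀ := mul_nonneg p.γ_pos.le (pow_nonneg p.ρ_pos.le _)
  calc _ ≤ p.γ * p.ρ ^ m₀ * (ℓ * ‖x - proj X (x - (p.γ * p.ρ ^ m₀) • G x)‖) :=
        mul_le_mul_of_nonneg_left (hG _ _) ht
    _ = (p.γ * p.ρ ^ m₀ * ℓ) * ‖x - proj X (x - (p.γ * p.ρ ^ m₀) • G x)‖ := by ring
    _ ≤ _ := mul_le_mul_of_nonneg_right hm₀ (norm_nonneg _)

theorem norm_le_of_lipschitz {E F : Type*} [NormedAddCommGroup E] [NormedAddCommGroup F]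
    {H : E → F} {l : ℝ} (hH : ∀ x y, ‖H x - H y‖ ≤ l * ‖x - y‖) (x y : E) :
    ‖H x‖ ≤ ‖H y‖ + l * ‖x - y‖ := by
  have := norm_le_norm_add_norm_sub' (H x) (H y)
  linarith [hH x y]

theorem sq_add_three_le (a b c : ℝ) : (a + b + c) ^ 2 ≤ 3 * (a ^ 2 + b ^ 2 + c ^ 2) := by
  nlinarith [sq_nonneg (a - b), sq_nonneg (b - c), sq_nonneg (a - c)]

/-! ### Errors of one iteration for a fixed sample -/

section Pointwise

variable {n : ℕ} {X : Set (Rn n)} (hcl : IsClosed X) (hcv : Convex ℝ X) {p : Params}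
  {G H : Rn n → Rn n} {l ℓ : ℝ} {xs : Rn n} (hxs : xs ∈ X)

theorem norm_le_add_of_lipschitz (hH : ∀ x y, ‖H x - H y‖ ≤ l * ‖x - y‖) (x xs : Rn n) :
    ‖G x‖ ≤ ‖G x - H x‖ + (‖H xs‖ + l * ‖x - xs‖) := by
  have := norm_le_norm_add_norm_sub (H x) (G x)
  have h2 := norm_le_norm_add_norm_sub' (G x) (H x)
  linarith [norm_le_of_lipschitz hH x xs]

include hcl hcv hxs

/-- `G` need not be Lipschitz: comparing `G x` with `H x` leaves a constant that depends on `H`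
only, hence not on the sample. -/
theorem norm_proj_step_sub_le (hl : 0 ≤ l) (hH : ∀ x y, ‖H x - H y‖ ≤ l * ‖x - y‖)
    (x : Rn n) {t : ℝ} (ht0 : 0 ≤ t) (ht1 : t ≤ 1) :
    ‖proj X (x - t • G x) - xs‖ ≤ (1 + ‖H xs‖ + l) * (1 + ‖x - xs‖ + ‖G x - H x‖) := by
  have h1 := norm_proj_sub_le hcl hcv (x - t • G x) hxs
  have h2 : ‖x - t • G x - xs‖ ≤ ‖x - xs‖ + t * ‖G x‖ := by
    rw [sub_right_comm, ← Real.norm_of_nonneg ht0, ← norm_smul, Real.norm_of_nonneg ht0]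
    exact norm_sub_le _ _
  have h3 : t * ‖G x‖ ≤ ‖G x‖ := mul_le_of_le_one_left (norm_nonneg _) ht1
  have h4 := norm_le_add_of_lipschitz (G := G) hH x xs
  have := mul_nonneg (norm_nonneg (H xs)) (norm_nonneg (x - xs))
  have := mul_nonneg (norm_nonneg (H xs)) (norm_nonneg (G x - H x))
  have := mul_nonneg hl (norm_nonneg (G x - H x))
  linarith

theorem norm_proj_step_sub_sq_le (hl : 0 ≤ l) (hH : ∀ x y, ‖H x - H y‖ ≤ l * ‖x - y‖)
    (x : Rn n) {t : ℝ} (ht0 : 0 ≤ t) (ht1 : t ≤ 1) :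
    ‖proj X (x - t • G x) - xs‖ ^ 2
      ≤ 3 * (1 + ‖H xs‖ + l) ^ 2 * (1 + ‖x - xs‖ ^ 2 + ‖G x - H x‖ ^ 2) := by
  have h := pow_le_pow_left₀ (norm_nonneg _)
    (norm_proj_step_sub_le hcl hcv hxs (G := G) hl hH x ht0 ht1) 2
  rw [mul_pow] at h
  have h2 := mul_le_mul_of_nonneg_left (sq_add_three_le 1 ‖x - xs‖ ‖G x - H x‖)
    (sq_nonneg (1 + ‖H xs‖ + l))
  linarith

set_option maxHeartbeats 800000 in
/-- The error of the sampled operator `G` at the half step, which depends on `G`, in terms of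
errors at points that do not, and of the deviation of its Lipschitz constant. -/
theorem stepSize_sq_mul_error_sq_le (hl : 1 ≤ l) (hH : ∀ x y, ‖H x - H y‖ ≤ l * ‖x - y‖)
    (hℓ : 0 < ℓ) (hG : ∀ x y, ‖G x - G y‖ ≤ ℓ * ‖x - y‖) {m₀ : ℕ}
    (hm₀ : p.γ * p.ρ ^ m₀ * (2 * l) ≤ p.μ) (x : Rn n) :
    stepSize X p G x ^ 2 * ‖G (proj X (x - stepSize X p G x • G x))
        - H (proj X (x - stepSize X p G x • G x))‖ ^ 2
      ≤ 27 * (1 + ‖H xs‖ + l) ^ 4 * ((1 + ‖x - xs‖ ^ 2) * (ℓ - l) ^ 2 + ‖G x - H x‖ ^ 2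
        + ∑ m ∈ Finset.range (m₀ + 1), ‖G (proj X (x - (p.γ * p.ρ ^ m) • H x))
          - H (proj X (x - (p.γ * p.ρ ^ m) • H x))‖ ^ 2) := by
  have ht0 := stepSize_pos X p G x
  have ht1 := stepSize_le_one X p G x
  have hY := norm_proj_step_sub_le hcl hcv hxs (G := G) (by linarith) hH x ht0.le ht1
  have hμ1 : p.μ ≤ 1 := by
    have h3 : √3 ≤ 2 := Real.sqrt_le_iff.2 ⟨by norm_num, by norm_num⟩
    linarith [p.μ_lt]
  have hh0 := norm_nonneg (H xs)
  have hD := norm_nonneg (x - xs)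
  have hv := norm_nonneg (G x - H x)
  set S := ∑ m ∈ Finset.range (m₀ + 1), ‖G (proj X (x - (p.γ * p.ρ ^ m) • H x))
          - H (proj X (x - (p.γ * p.ρ ^ m) • H x))‖ ^ 2 with hS
  have hS0 : 0 ≤ S := Finset.sum_nonneg fun m _ => sq_nonneg _
  have hB : 1 + l ≤ 1 + ‖H xs‖ + l := by linarith
  have hB4 : 1 + l ≤ (1 + ‖H xs‖ + l) ^ 4 := hB.trans (le_self_pow₀ (by linarith) (by norm_num))
  have hB2 : (1 + l) ^ 2 ≤ (1 + ‖H xs‖ + l) ^ 4 :=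
    (pow_le_pow_left₀ (by linarith) hB 2).trans
      (pow_le_pow_right₀ (by linarith) (by norm_num))
  -- If `ℓ ≤ 2l`, at most `m₀` reductions occur, and `y` is compared with `y'`, the same step taken
  -- with `H`: for each of the finitely many step sizes this point does not depend on `G`.
  rcases le_or_gt ℓ (2 * l) with hc | hc
  · obtain ⟨m, hm, hmt⟩ := exists_stepSize_eq X p G hG x (m₀ := m₀)
      ((mul_le_mul_of_nonneg_left hc
        (mul_nonneg p.γ_pos.le (pow_nonneg p.ρ_pos.le _))).trans hm₀)
    have hs : ‖G (proj X (x - (stepSize X p G x) • H x))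
          - H (proj X (x - (stepSize X p G x) • H x))‖ ^ 2 ≤ S := by
      rw [hmt, hS]
      exact Finset.single_le_sum (f := fun m => ‖G (proj X (x - (p.γ * p.ρ ^ m) • H x))
          - H (proj X (x - (p.γ * p.ρ ^ m) • H x))‖ ^ 2) (fun i _ => sq_nonneg _)
          (Finset.mem_range.2 (Nat.lt_succ_of_le hm))
    generalize stepSize X p G x = t at *
    set y := proj X (x - t • G x)
    set y' := proj X (x - t • H x)
    have h1 : ‖y - y'‖ ≤ ‖G x - H x‖ := by
      refine (norm_proj_sub_proj_le ⟨xs, hxs⟩ hcl hcv _ _).trans ?_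
      rw [sub_sub_sub_cancel_left, ← smul_sub, norm_smul, Real.norm_of_nonneg ht0.le,
        norm_sub_rev]
      exact mul_le_of_le_one_left (norm_nonneg _) ht1
    have h2 : ‖G y - H y‖ ≤ 3 * l * ‖G x - H x‖ + ‖G y' - H y'‖ := by
      have e : G y - H y = (G y - G y') + (G y' - H y') + (H y' - H y) := by abel
      have h3 := norm_add₃_le (a := G y - G y') (b := G y' - H y') (c := H y' - H y)
      rw [← e] at h3
      have h4 := hG y y'
      have h5 := hH y' y
      rw [norm_sub_rev y' y] at h5
      have h6 : (ℓ + l) * ‖y - y'‖ ≤ 3 * l * ‖G x - H x‖ :=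
        mul_le_mul (by linarith) h1 (norm_nonneg _) (by linarith)
      linarith
    have h7 : t ^ 2 * ‖G y - H y‖ ^ 2 ≤ ‖G y - H y‖ ^ 2 :=
      mul_le_of_le_one_left (sq_nonneg _) (pow_le_one₀ ht0.le ht1)
    have h8 := pow_le_pow_left₀ (norm_nonneg _) h2 2
    have h9 : (3 * l * ‖G x - H x‖ + ‖G y' - H y'‖) ^ 2
        ≤ 18 * l ^ 2 * ‖G x - H x‖ ^ 2 + 2 * ‖G y' - H y'‖ ^ 2 := by
      nlinarith [sq_nonneg (3 * l * ‖G x - H x‖ - ‖G y' - H y'‖)]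
    have h10 : l ^ 2 * ‖G x - H x‖ ^ 2 ≤ (1 + ‖H xs‖ + l) ^ 4 * ‖G x - H x‖ ^ 2 :=
      mul_le_mul_of_nonneg_right (by nlinarith) (sq_nonneg _)
    have h11 : 1 * S ≤ (1 + ‖H xs‖ + l) ^ 4 * S :=
      mul_le_mul_of_nonneg_right (by linarith) hS0
    have h12 : 0 ≤ (1 + ‖H xs‖ + l) ^ 4 * ((1 + ‖x - xs‖ ^ 2) * (ℓ - l) ^ 2) := by positivity
    have h13 : 0 ≤ (1 + ‖H xs‖ + l) ^ 4 * ‖G x - H x‖ ^ 2 := by positivity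
    linarith
  · have hline := lineSearchTest_stepSize X p G hℓ hG x
    unfold LineSearchTest at hline
    generalize stepSize X p G x = t at *
    set y := proj X (x - t • G x)
    -- Here `ℓ` is uncontrolled, so the line search test, not the Lipschitz bound, controls `t ‖G x
    -- - G y‖`.
    have h1 : t * ‖G y - H y‖ ≤ t * ‖G x - G y‖ + t * ‖G x‖ + t * ‖H y‖ := by
      have e : G y - H y = -(G x - G y) + G x + -(H y) := by abel
      have h3 := norm_add₃_le (a := -(G x - G y)) (b := G x) (c := -(H y))
      rw [← e, norm_neg, norm_neg] at h3
      linarith [mul_le_mul_of_nonneg_left h3 ht0.le]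
    have h2 : t * ‖G x‖ ≤ ‖G x‖ := mul_le_of_le_one_left (norm_nonneg _) ht1
    have h3 : t * ‖H y‖ ≤ ‖H y‖ := mul_le_of_le_one_left (norm_nonneg _) ht1
    have h4 : p.μ * ‖x - y‖ ≤ ‖x - y‖ := mul_le_of_le_one_left (norm_nonneg _) hμ1
    have h5 : ‖x - y‖ ≤ ‖x - xs‖ + ‖y - xs‖ := by
      rw [norm_sub_rev y xs]
      exact norm_sub_le_norm_sub_add_norm_sub x xs y
    have h6 := norm_le_add_of_lipschitz (G := G) hH x xs
    have h7 := norm_le_of_lipschitz hH y xs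
    have h8 : t * ‖G y - H y‖
        ≤ 3 * (1 + ‖H xs‖ + l) ^ 2 * (1 + ‖x - xs‖ + ‖G x - H x‖) := by
      set B := 1 + ‖H xs‖ + l with hBdef
      set U := 1 + ‖x - xs‖ + ‖G x - H x‖ with hU
      have hU1 : 1 ≤ U := by linarith
      have h9 : (1 + l) * ‖y - xs‖ ≤ B * (B * U) :=
        mul_le_mul hB hY (norm_nonneg _) (by linarith)
      have h10 : ‖x - xs‖ + ‖G x - H x‖ + 2 * ‖H xs‖ + l * ‖x - xs‖ ≤ 2 * B * U := by
        have := mul_nonneg hh0 hD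
        have := mul_nonneg hh0 hv
        have := mul_nonneg (by linarith : 0 ≤ l) hv
        have := mul_nonneg (by linarith : 0 ≤ l) hD
        rw [hBdef, hU]
        linarith
      have h11 : B * U ≤ B * (B * U) :=
        le_mul_of_one_le_left (by positivity) (by linarith)
      linarith
    have h9 := pow_le_pow_left₀ (by positivity) h8 2
    have h10 := sq_add_three_le 1 ‖x - xs‖ ‖G x - H x‖
    have h11 := mul_le_mul_of_nonneg_left h10
      (by positivity : 0 ≤ 9 * (1 + ‖H xs‖ + l) ^ 4)
    -- `ℓ > 2l` and `l ≥ 1` give `(ℓ - l)² ≥ 1`, so the deviation of `ℓ` pays for the quadratic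
    -- growth.
    have h12 : 1 * (1 + ‖x - xs‖ ^ 2) ≤ (ℓ - l) ^ 2 * (1 + ‖x - xs‖ ^ 2) :=
      mul_le_mul_of_nonneg_right (by nlinarith) (by positivity)
    have h13 : 27 * (1 + ‖H xs‖ + l) ^ 4 * (1 ^ 2 + ‖x - xs‖ ^ 2 + ‖G x - H x‖ ^ 2)
        ≤ 27 * (1 + ‖H xs‖ + l) ^ 4 * ((1 + ‖x - xs‖ ^ 2) * (ℓ - l) ^ 2
          + ‖G x - H x‖ ^ 2 + S) :=
      mul_le_mul_of_nonneg_left (by linarith) (by positivity)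
    calc t ^ 2 * ‖G y - H y‖ ^ 2 = (t * ‖G y - H y‖) ^ 2 := by ring
      _ ≤ _ := h9
      _ = 9 * (1 + ‖H xs‖ + l) ^ 4 * (1 + ‖x - xs‖ + ‖G x - H x‖) ^ 2 := by ring
      _ ≤ _ := h11
      _ = _ := by ring
      _ ≤ _ := h13

theorem residual_le (hH : ∀ x y, ‖H x - H y‖ ≤ l * ‖x - y‖) {γ : ℝ} (hγ0 : 0 ≤ γ) (hγ1 : γ ≤ 1)
    (x : Rn n) : residual X H γ x ≤ ‖H xs‖ + (2 + l) * ‖x - xs‖ := by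
  unfold residual
  have h1 := norm_proj_sub_le hcl hcv (x - γ • H x) hxs
  have h2 : ‖x - γ • H x - xs‖ ≤ ‖x - xs‖ + γ * ‖H x‖ := by
    rw [sub_right_comm, ← Real.norm_of_nonneg hγ0, ← norm_smul, Real.norm_of_nonneg hγ0]
    exact norm_sub_le _ _
  have h3 : γ * ‖H x‖ ≤ ‖H x‖ := mul_le_of_le_one_left (norm_nonneg _) hγ1
  have h4 := norm_le_of_lipschitz hH x xs
  have h5 := norm_sub_le_norm_sub_add_norm_sub (proj X (x - γ • H x)) xs x
  rw [norm_sub_rev xs x] at h5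
  linarith

theorem residual_sq_le (hl : 0 ≤ l) (hH : ∀ x y, ‖H x - H y‖ ≤ l * ‖x - y‖) {γ : ℝ}
    (hγ0 : 0 ≤ γ) (hγ1 : γ ≤ 1) (x : Rn n) :
    residual X H γ x ^ 2 ≤ 2 * (2 + ‖H xs‖ + l) ^ 2 * (1 + ‖x - xs‖ ^ 2) := by
  have h := residual_le hcl hcv hxs hH hγ0 hγ1 x
  have h0 : 0 ≤ residual X H γ x := norm_nonneg _
  have h1 : residual X H γ x ≤ (2 + ‖H xs‖ + l) * (1 + ‖x - xs‖) := by
    have := mul_nonneg (norm_nonneg (H xs)) (norm_nonneg (x - xs))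
    linarith
  have h2 := pow_le_pow_left₀ h0 h1 2
  have h3 : (1 + ‖x - xs‖) ^ 2 ≤ 2 * (1 + ‖x - xs‖ ^ 2) := by
    nlinarith [sq_nonneg (1 - ‖x - xs‖)]
  rw [mul_pow] at h2
  linarith [mul_le_mul_of_nonneg_left h3 (sq_nonneg (2 + ‖H xs‖ + l))]

/-- The residual of the mean operator is controlled by the step of the sampled one. -/
theorem residual_sq_le_sampled (hl : 1 ≤ l) (hH : ∀ x y, ‖H x - H y‖ ≤ l * ‖x - y‖)
    (hG : ∀ x y, ‖G x - G y‖ ≤ ℓ * ‖x - y‖) {m₀ : ℕ}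
    (hm₀ : p.γ * p.ρ ^ m₀ * (2 * l) ≤ p.μ) (x : Rn n) :
    (p.ρ ^ m₀) ^ 2 * residual X H p.γ x ^ 2
      ≤ 2 * (stepSize X p G x / p.γ * ‖proj X (x - p.γ • G x) - x‖) ^ 2
      + 2 * (2 + ‖H xs‖ + l) ^ 2 * ((1 + ‖x - xs‖ ^ 2) * (ℓ - l) ^ 2 + ‖G x - H x‖ ^ 2) := by
  have hγ := p.γ_pos
  have hρm : 0 < p.ρ ^ m₀ := pow_pos p.ρ_pos _
  have hρ1 : p.ρ ^ m₀ ≤ 1 := pow_le_one₀ p.ρ_pos.le p.ρ_lt_one.le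
  have hh0 := norm_nonneg (H xs)
  have hr0 : 0 ≤ residual X H p.γ x := norm_nonneg _
  have hV : 1 * ‖G x - H x‖ ^ 2 ≤ (2 + ‖H xs‖ + l) ^ 2 * ‖G x - H x‖ ^ 2 :=
    mul_le_mul_of_nonneg_right (one_le_pow₀ (by linarith)) (sq_nonneg _)
  -- Either the accepted step is at least `γ ρ^m₀`, or the growth bound for the residual is paid for
  -- by `(ℓ - l)² ≥ 1`.
  rcases le_or_gt ℓ (2 * l) with hc | hc
  · obtain ⟨m, hm, hmt⟩ := exists_stepSize_eq X p G hG x (m₀ := m₀)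
      ((mul_le_mul_of_nonneg_left hc
        (mul_nonneg p.γ_pos.le (pow_nonneg p.ρ_pos.le _))).trans hm₀)
    have h1 : p.ρ ^ m₀ ≤ stepSize X p G x / p.γ := by
      rw [hmt, mul_div_cancel_left₀ _ hγ.ne']
      exact pow_le_pow_of_le_one p.ρ_pos.le p.ρ_lt_one.le hm
    have h2 : residual X H p.γ x ≤ ‖proj X (x - p.γ • G x) - x‖ + ‖G x - H x‖ := by
      have h3 := norm_sub_le_norm_sub_add_norm_sub (proj X (x - p.γ • H x))
        (proj X (x - p.γ • G x)) x
      have h4 : ‖proj X (x - p.γ • H x) - proj X (x - p.γ • G x)‖ ≤ ‖G x - H x‖ := by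
        refine (norm_proj_sub_proj_le ⟨xs, hxs⟩ hcl hcv _ _).trans ?_
        rw [sub_sub_sub_cancel_left, ← smul_sub, norm_smul, Real.norm_of_nonneg hγ.le]
        exact mul_le_of_le_one_left (norm_nonneg _) p.γ_le_one
      unfold residual
      linarith
    have h3 : p.ρ ^ m₀ * residual X H p.γ x
        ≤ stepSize X p G x / p.γ * ‖proj X (x - p.γ • G x) - x‖ + ‖G x - H x‖ := by
      have h4 := mul_le_mul_of_nonneg_left h2 hρm.le
      have h5 := mul_le_mul_of_nonneg_right h1 (norm_nonneg (proj X (x - p.γ • G x) - x))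
      have h6 := mul_le_of_le_one_left (norm_nonneg (G x - H x)) hρ1
      linarith
    have h4 := pow_le_pow_left₀ (by positivity) h3 2
    rw [mul_pow] at h4
    have h5 : 0 ≤ (2 + ‖H xs‖ + l) ^ 2 * ((1 + ‖x - xs‖ ^ 2) * (ℓ - l) ^ 2) := by positivity
    linarith [sq_nonneg (stepSize X p G x / p.γ * ‖proj X (x - p.γ • G x) - x‖ - ‖G x - H x‖)]
  · have h1 := residual_sq_le hcl hcv hxs (by linarith) hH hγ.le p.γ_le_one x
    have h2 : (p.ρ ^ m₀) ^ 2 * residual X H p.γ x ^ 2 ≤ residual X H p.γ x ^ 2 :=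
      mul_le_of_le_one_left (sq_nonneg _) (pow_le_one₀ hρm.le hρ1)
    have h3 : 1 * (1 + ‖x - xs‖ ^ 2) ≤ (ℓ - l) ^ 2 * (1 + ‖x - xs‖ ^ 2) :=
      mul_le_mul_of_nonneg_right (by nlinarith) (by positivity)
    have h4 := mul_le_mul_of_nonneg_left h3 (by positivity : 0 ≤ 2 * (2 + ‖H xs‖ + l) ^ 2)
    have h5 := sq_nonneg (stepSize X p G x / p.γ * ‖proj X (x - p.γ • G x) - x‖)
    linarith [sq_nonneg ‖G x - H x‖]

end Pointwise

set_option maxHeartbeats 800000 in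
/-- One iteration decreases the energy by a multiple of the squared residual, up to sampling errors
that are evaluated at points independent of the samples they refer to. -/
theorem exists_step_le {n : ℕ} {X : Set (Rn n)} (hcl : IsClosed X) (hcv : Convex ℝ X)
    (p : Params) {H : Rn n → Rn n} {l : ℝ} {xs : Rn n} (hxs : xs ∈ X) (hl : 1 ≤ l)
    (hH : ∀ x y, ‖H x - H y‖ ≤ l * ‖x - y‖) (hsol : ∀ y ∈ X, 0 ≤ inner ℝ (H y) (y - xs)) :
    ∃ (m₀ : ℕ) (c A : ℝ), 0 < c ∧ 0 < A ∧ ∀ (G K : Rn n → Rn n) (ℓ w : ℝ) (x : Rn n) (θ : ℕ),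
      0 < ℓ → (∀ x y, ‖G x - G y‖ ≤ ℓ * ‖x - y‖) → 1 ≤ w →
      ‖(step X p G K (x, θ)).1 - xs‖ ^ 2 + potential p (step X p G K (x, θ)).2
          + c * residual X H p.γ x ^ 2
        ≤ ‖x - xs‖ ^ 2 + potential p θ + A * ((1 + ‖x - xs‖ ^ 2) * (ℓ - l) ^ 2
          + ‖G x - H x‖ ^ 2 + ∑ m ∈ Finset.range (m₀ + 1),
            ‖G (proj X (x - (p.γ * p.ρ ^ m) • H x)) - H (proj X (x - (p.γ * p.ρ ^ m) • H x))‖ ^ 2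
          + w * ‖K (proj X (x - stepSize X p G x • G x))
              - H (proj X (x - stepSize X p G x • G x))‖ ^ 2
          + (1 + ‖x - xs‖ ^ 2) / w) := by
  obtain ⟨m₀, hm₀⟩ := exists_pow_lt_of_lt_one
    (div_pos p.μ_pos (mul_pos p.γ_pos (by linarith : 0 < 2 * l))) p.ρ_lt_one
  have hm₀' : p.γ * p.ρ ^ m₀ * (2 * l) ≤ p.μ := by
    rw [lt_div_iff₀ (mul_pos p.γ_pos (by linarith : 0 < 2 * l))] at hm₀
    linarith
  set B := 2 + ‖H xs‖ + l with hB
  have hB3 : 3 ≤ B := by linarith [norm_nonneg (H xs)]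
  have hM := p.M_pos
  have hρm : 0 < p.ρ ^ m₀ := pow_pos p.ρ_pos _
  -- Dividing `residual_sq_le_sampled` by `12` matches the decrease `R² / 6` of `step_energy_le`.
  -- The summand `B ^ 2` of the second constant covers its remainder, the other one covers the
  -- sampling errors.
  refine ⟨m₀, (p.ρ ^ m₀) ^ 2 / 12, B ^ 2 + (1 + p.M) * (150 * B ^ 4), by positivity,
    by positivity, ?_⟩
  intro G K ℓ w x θ hℓ hG hw
  have ht0 := stepSize_pos X p G x
  have ht1 := stepSize_le_one X p G x
  have h1 := step_energy_le hcl hcv p G K x θ hxs (potential p) (potential_succ p θ).le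
    (lineSearchTest_stepSize X p G hℓ hG x) (hsol _ (proj_spec ⟨xs, hxs⟩ hcl _).1)
  have h2 := stepSize_sq_mul_error_sq_le hcl hcv hxs hl hH hℓ hG hm₀' x
  have h3 := residual_sq_le_sampled hcl hcv hxs hl hH hG hm₀' x
  have h4 := norm_proj_step_sub_sq_le hcl hcv hxs (G := G) (by linarith) hH x ht0.le ht1
  generalize stepSize X p G x / p.γ * ‖proj X (x - p.γ • G x) - x‖ = R at *
  generalize ‖(step X p G K (x, θ)).1 - xs‖ ^ 2 + potential p (step X p G K (x, θ)).2 = V' at *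
  generalize ‖x - xs‖ ^ 2 + potential p θ = V at *
  generalize residual X H p.γ x = r at *
  generalize stepSize X p G x = t at *
  set y := proj X (x - t • G x) with hy
  have hS0 : 0 ≤ ∑ m ∈ Finset.range (m₀ + 1), ‖G (proj X (x - (p.γ * p.ρ ^ m) • H x))
      - H (proj X (x - (p.γ * p.ρ ^ m) • H x))‖ ^ 2 := Finset.sum_nonneg fun m _ => sq_nonneg _
  generalize ∑ m ∈ Finset.range (m₀ + 1), ‖G (proj X (x - (p.γ * p.ρ ^ m) • H x))
    - H (proj X (x - (p.γ * p.ρ ^ m) • H x))‖ ^ 2 = S at *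
  have hv0 := sq_nonneg ‖G x - H x‖
  have hP0 : 0 ≤ (1 + ‖x - xs‖ ^ 2) * (ℓ - l) ^ 2 := by positivity
  have hw0 : 0 < w := by linarith
  have hW0 : 0 ≤ (1 + ‖x - xs‖ ^ 2) / w := by positivity
  have he0 : 0 ≤ w * ‖K y - H y‖ ^ 2 := by positivity
  have h5 : t ^ 2 * ‖G y - K y‖ ^ 2 ≤ 2 * (t ^ 2 * ‖G y - H y‖ ^ 2) + 2 * (w * ‖K y - H y‖ ^ 2) := by
    have h6 := norm_sub_le_norm_sub_add_norm_sub (G y) (H y) (K y)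
    rw [norm_sub_rev (H y) (K y)] at h6
    have h7 : ‖G y - K y‖ ^ 2 ≤ 2 * ‖G y - H y‖ ^ 2 + 2 * ‖K y - H y‖ ^ 2 := by
      nlinarith [pow_le_pow_left₀ (norm_nonneg _) h6 2, sq_nonneg (‖G y - H y‖ - ‖K y - H y‖)]
    have h8 := mul_le_mul_of_nonneg_left h7 (sq_nonneg t)
    have h9 : t ^ 2 * ‖K y - H y‖ ^ 2 ≤ w * ‖K y - H y‖ ^ 2 :=
      mul_le_mul_of_nonneg_right ((pow_le_one₀ ht0.le ht1).trans hw) (sq_nonneg _)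
    linarith
  -- Young's inequality with the free weight `w`, chosen later as the square root of the sample
  -- size.
  have h6 : 2 * t * (‖K y - H y‖ * ‖y - xs‖) ≤ w * ‖K y - H y‖ ^ 2 + ‖y - xs‖ ^ 2 / w := by
    have h7 : t * (‖K y - H y‖ * ‖y - xs‖) ≤ ‖K y - H y‖ * ‖y - xs‖ :=
      mul_le_of_le_one_left (by positivity) ht1
    have h8 : w * ‖K y - H y‖ ^ 2 + ‖y - xs‖ ^ 2 / w - 2 * (‖K y - H y‖ * ‖y - xs‖)
        = (w * ‖K y - H y‖ - ‖y - xs‖) ^ 2 / w := by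
      field_simp
      ring
    have h9 : 0 ≤ (w * ‖K y - H y‖ - ‖y - xs‖) ^ 2 / w := by positivity
    linarith
  have hB2 : (1 + ‖H xs‖ + l) ^ 2 ≤ B ^ 4 :=
    (pow_le_pow_left₀ (by linarith) (by linarith) 2).trans
      (pow_le_pow_right₀ (by linarith) (by norm_num))
  have hB4 : (1 + ‖H xs‖ + l) ^ 4 ≤ B ^ 4 := pow_le_pow_left₀ (by linarith) (by linarith) 4
  have hB1 : 1 ≤ B ^ 4 := one_le_pow₀ (by linarith)
  have h7 : ‖y - xs‖ ^ 2 / w ≤ 3 * B ^ 4 * ((1 + ‖x - xs‖ ^ 2) / w + ‖G x - H x‖ ^ 2) := by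
    have h8 : 3 * (1 + ‖H xs‖ + l) ^ 2 * (1 + ‖x - xs‖ ^ 2 + ‖G x - H x‖ ^ 2)
        ≤ 3 * B ^ 4 * (1 + ‖x - xs‖ ^ 2 + ‖G x - H x‖ ^ 2) :=
      mul_le_mul_of_nonneg_right (by linarith) (by positivity)
    have h9 := div_le_div_of_nonneg_right (h4.trans h8) hw0.le
    rw [mul_div_assoc, add_div] at h9
    have h10 : ‖G x - H x‖ ^ 2 / w ≤ ‖G x - H x‖ ^ 2 := div_le_self hv0 hw
    exact h9.trans (mul_le_mul_of_nonneg_left (by linarith) (by positivity))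
  set Q := (1 + ‖x - xs‖ ^ 2) * (ℓ - l) ^ 2 + ‖G x - H x‖ ^ 2 + S with hQ
  have hQ0 : 0 ≤ Q := by linarith
  have h8 : 2 * t ^ 2 * ‖G y - K y‖ ^ 2 + 2 * t * (‖K y - H y‖ * ‖y - xs‖)
      ≤ 150 * B ^ 4 * (Q + w * ‖K y - H y‖ ^ 2 + (1 + ‖x - xs‖ ^ 2) / w) := by
    have h9 := mul_le_mul_of_nonneg_right hB4 hQ0
    have h10 := mul_le_mul_of_nonneg_right hB1 he0
    have h11 := mul_le_mul_of_nonneg_left (by linarith : ‖G x - H x‖ ^ 2 ≤ Q)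
      (by positivity : 0 ≤ B ^ 4)
    have h12 : 0 ≤ B ^ 4 * ((1 + ‖x - xs‖ ^ 2) / w) := by positivity
    have h13 : 0 ≤ B ^ 4 * Q := by positivity
    linarith
  have h9 := mul_le_mul_of_nonneg_left h8 (by linarith : 0 ≤ 1 + p.M)
  have h10 : B ^ 2 * ((1 + ‖x - xs‖ ^ 2) * (ℓ - l) ^ 2 + ‖G x - H x‖ ^ 2)
      ≤ B ^ 2 * (Q + w * ‖K y - H y‖ ^ 2 + (1 + ‖x - xs‖ ^ 2) / w) :=
    mul_le_mul_of_nonneg_left (by linarith) (by positivity)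
  have h11 : 0 ≤ B ^ 2 * ((1 + ‖x - xs‖ ^ 2) * (ℓ - l) ^ 2 + ‖G x - H x‖ ^ 2) := by positivity
  linarith

/-! ### Mean squared errors of sample averages -/

section Averages

variable {Ξ : Type*} [MeasurableSpace Ξ] {Q : Measure Ξ} [IsProbabilityMeasure Q] {m : ℕ}

theorem memLp_average_pi {f : Ξ → ℝ} (hf : MemLp f 2 Q) :
    MemLp (fun s : Fin m → Ξ => (m : ℝ)⁻¹ * ∑ j, f (s j)) 2 (Measure.pi fun _ => Q) :=
  (memLp_finsetSum Finset.univ fun j _ => hf.comp_measurePreserving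
    (measurePreserving_eval (fun _ => Q) j)).const_mul _

theorem integral_average_pi {f : Ξ → ℝ} (hf : Integrable f Q) (hm : 0 < m) :
    ∫ s : Fin m → Ξ, (m : ℝ)⁻¹ * ∑ j, f (s j) ∂(Measure.pi fun _ => Q) = ∫ x, f x ∂Q := by
  have hm' : (m : ℝ) ≠ 0 := by positivity
  rw [integral_const_mul, integral_finsetSum _ fun j _ =>
    integrable_comp_eval (μ := fun _ : Fin m => Q) hf]
  simp only [integral_comp_eval (μ := fun _ : Fin m => Q) hf.aestronglyMeasurable]
  simp [hm']

theorem integral_average_sub_sq_le {f : Ξ → ℝ} (hf : MemLp f 2 Q) (hm : 0 < m) :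
    ∫ s : Fin m → Ξ, ((m : ℝ)⁻¹ * ∑ j, f (s j) - ∫ x, f x ∂Q) ^ 2 ∂(Measure.pi fun _ => Q)
      ≤ (∫ x, f x ^ 2 ∂Q) / m := by
  have hm' : (m : ℝ) ≠ 0 := by positivity
  have h1 := variance_eq_integral (memLp_average_pi (m := m) hf).aemeasurable
  rw [integral_average_pi (hf.integrable one_le_two) hm] at h1
  rw [← h1, variance_const_mul]
  have h2 := variance_sum_pi (ι := Fin m) (μ := fun _ => Q) (X := fun _ => f) fun _ => hf
  have e : (∑ i, fun ω : Fin m → Ξ => f (ω i)) = fun s => ∑ j, f (s j) := by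
    ext s
    simp
  rw [← e, h2]
  simp only [Finset.sum_const, Finset.card_univ, Fintype.card_fin, nsmul_eq_mul]
  have h3 : Var[f; Q] ≤ ∫ x, f x ^ 2 ∂Q := variance_le_expectation_sq hf.aestronglyMeasurable
  rw [inv_pow, sq, mul_inv, mul_assoc, inv_mul_cancel_left₀ hm', div_eq_inv_mul]
  exact mul_le_mul_of_nonneg_left h3 (by positivity)

theorem integrable_average_sub_sq {f : Ξ → ℝ} (hf : MemLp f 2 Q) (a : ℝ) :
    Integrable (fun s : Fin m → Ξ => ((m : ℝ)⁻¹ * ∑ j, f (s j) - a) ^ 2)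
      (Measure.pi fun _ => Q) :=
  ((memLp_average_pi hf).sub (memLp_const a)).integrable_sq

theorem lintegral_average_sub_sq_le {f : Ξ → ℝ} (hf : MemLp f 2 Q) (hm : 0 < m) :
    ∫⁻ s : Fin m → Ξ, ENNReal.ofReal (((m : ℝ)⁻¹ * ∑ j, f (s j) - ∫ x, f x ∂Q) ^ 2)
      ∂(Measure.pi fun _ => Q) ≤ ENNReal.ofReal ((∫ x, f x ^ 2 ∂Q) / m) := by
  rw [← ofReal_integral_eq_lintegral_ofReal
    (integrable_average_sub_sq hf _)
    (ae_of_all _ fun _ => sq_nonneg _)]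
  exact ENNReal.ofReal_le_ofReal (integral_average_sub_sq_le hf hm)

/-- The mean squared error of a sample average is at most the second moment over the sample size. -/
theorem lintegral_norm_average_sub_sq_le {n : ℕ} {f : Ξ → Rn n} (hf : MemLp f 2 Q) (hm : 0 < m) :
    ∫⁻ s : Fin m → Ξ, ENNReal.ofReal (‖(m : ℝ)⁻¹ • ∑ j, f (s j) - ∫ x, f x ∂Q‖ ^ 2)
      ∂(Measure.pi fun _ => Q) ≤ ENNReal.ofReal ((∫ x, ‖f x‖ ^ 2 ∂Q) / m) := by
  have hc : ∀ i : Fin n, MemLp (fun x => f x i) 2 Q := fun i =>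
    hf.of_le (((EuclideanSpace.proj (𝕜 := ℝ) i).continuous.comp_aestronglyMeasurable
      hf.aestronglyMeasurable)) (ae_of_all _ fun x => PiLp.norm_apply_le (f x) i)
  have hint : ∀ i : Fin n, (∫ x, f x ∂Q) i = ∫ x, f x i ∂Q := fun i =>
    ((EuclideanSpace.proj (𝕜 := ℝ) i).integral_comp_comm (hf.integrable one_le_two)).symm
  have e : ∀ s : Fin m → Ξ, ENNReal.ofReal (‖(m : ℝ)⁻¹ • ∑ j, f (s j) - ∫ x, f x ∂Q‖ ^ 2)
      = ∑ i, ENNReal.ofReal (((m : ℝ)⁻¹ * ∑ j, f (s j) i - ∫ x, f x i ∂Q) ^ 2) := by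
    intro s
    rw [EuclideanSpace.real_norm_sq_eq, ENNReal.ofReal_sum_of_nonneg fun _ _ => sq_nonneg _]
    refine Finset.sum_congr rfl fun i _ => ?_
    simp [hint]
  simp only [e]
  rw [lintegral_finsetSum' _ fun i _ => (integrable_average_sub_sq (hc i) _).aestronglyMeasurable.aemeasurable.ennreal_ofReal]
  refine (Finset.sum_le_sum fun i _ => lintegral_average_sub_sq_le (hc i) hm).trans ?_
  rw [← ENNReal.ofReal_sum_of_nonneg fun i _ =>
    div_nonneg (integral_nonneg fun _ => sq_nonneg _) (Nat.cast_nonneg m)]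
  refine ENNReal.ofReal_le_ofReal ?_
  rw [← Finset.sum_div, ← integral_finsetSum _ fun i _ => (hc i).integrable_sq]
  simp [EuclideanSpace.real_norm_sq_eq]

end Averages

/-! ### Second moments of the oracle -/

section Oracle

variable {n : ℕ} {Ξ : Type*} [MeasurableSpace Ξ] {Q : Measure Ξ} [IsProbabilityMeasure Q]

/-- Pointwise `‖f‖² ≤ 1 + ‖f‖^(2q)`. The analysis uses the higher moments of the oracle only through
the square integrability obtained here. -/
theorem memLp_two_of_rpow {E : Type*} [NormedAddCommGroup E] {f : Ξ → E}
    (hf : AEStronglyMeasurable f Q) {q : ℝ} (hq : 2 ≤ q)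
    (hint : Integrable (fun s => ‖f s‖ ^ (2 * q)) Q) : MemLp f 2 Q := by
  rw [memLp_two_iff_integrable_sq_norm hf]
  refine Integrable.mono' ((integrable_const (1 : ℝ)).add hint) (hf.norm.pow 2)
    (ae_of_all _ fun s => ?_)
  rw [Real.norm_of_nonneg (sq_nonneg _)]
  simp only [Pi.add_apply]
  rcases le_or_gt ‖f s‖ 1 with h | h
  · have := Real.rpow_nonneg (norm_nonneg (f s)) (2 * q)
    have := pow_le_one₀ (n := 2) (norm_nonneg (f s)) h
    linarith
  · have := Real.rpow_le_rpow_of_exponent_le h.le (by linarith : (2 : ℝ) ≤ 2 * q)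
    rw [Real.rpow_two] at this
    linarith

/-- What the analysis uses of the oracle `T`, in terms of the law `Q` of a sample. -/
structure SquareLipschitz (Q : Measure Ξ) (T : Ξ → Rn n → Rn n) (L : Ξ → ℝ) : Prop where
  measurable : Measurable (Function.uncurry T)
  memLp_modulus : MemLp L 2 Q
  one_le : ∀ᵐ s ∂Q, 1 ≤ L s
  lipschitz : ∀ᵐ s ∂Q, ∀ x y : Rn n, ‖T s x - T s y‖ ≤ L s * ‖x - y‖
  memLp : ∀ x, MemLp (fun s => T s x) 2 Q

variable {T : Ξ → Rn n → Rn n} {L : Ξ → ℝ}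

theorem measurable_section (hT : Measurable (Function.uncurry T)) (x : Rn n) :
    Measurable fun s => T s x :=
  hT.comp (measurable_id.prodMk measurable_const)

theorem OracleAssumption.exists_squareLipschitz {Ω : Type*} [MeasurableSpace Ω] {P : Measure Ω}
    [IsProbabilityMeasure P] {ξ : Ω → Ξ} (hξ : Measurable ξ)
    (hT : Measurable (Function.uncurry T)) (h : OracleAssumption P ξ T) :
    ∃ L, SquareLipschitz (P.map ξ) T L := by
  have := Measure.isProbabilityMeasure_map (μ := P) hξ.aemeasurable
  obtain ⟨L, hLm, hL1, hLip, p, hp, hLp⟩ := h.lipschitz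
  obtain ⟨x₁, q, hq, hTq⟩ := h.moment
  have hL2 : MemLp L 2 (P.map ξ) := by
    refine memLp_two_of_rpow hLm.aestronglyMeasurable hp ?_
    have h1 : Integrable (fun s => L s ^ (2 * p)) (P.map ξ) :=
      (integrable_map_measure (hLm.pow_const _).aestronglyMeasurable hξ.aemeasurable).2 hLp
    refine h1.congr ?_
    filter_upwards [hL1] with s hs
    rw [Real.norm_of_nonneg (by linarith)]
  have hT2 : MemLp (fun s => T s x₁) 2 (P.map ξ) :=
    memLp_two_of_rpow (measurable_section hT x₁).aestronglyMeasurable hq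
      ((integrable_map_measure ((measurable_section hT x₁).norm.pow_const _).aestronglyMeasurable
        hξ.aemeasurable).2 hTq)
  refine ⟨L, hT, hL2, hL1, hLip, fun x => ?_⟩
  have h3 : MemLp (fun s => T s x - T s x₁) 2 (P.map ξ) := by
    refine (hL2.mul_const ‖x - x₁‖).mono
      ((measurable_section hT x).sub (measurable_section hT x₁)).aestronglyMeasurable ?_
    filter_upwards [hLip] with s hs
    exact (hs x x₁).trans (le_abs_self _)
  refine (h3.add hT2).ae_eq (ae_of_all _ fun s => ?_)
  simp

theorem SquareLipschitz.one_le_integral (h : SquareLipschitz Q T L) : 1 ≤ ∫ s, L s ∂Q := by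
  have := integral_mono_ae (integrable_const (1 : ℝ)) (h.memLp_modulus.integrable one_le_two)
    h.one_le
  simpa using this

theorem SquareLipschitz.norm_integral_sub_le (h : SquareLipschitz Q T L) (x y : Rn n) :
    ‖∫ s, T s x ∂Q - ∫ s, T s y ∂Q‖ ≤ (∫ s, L s ∂Q) * ‖x - y‖ := by
  rw [← integral_sub ((h.memLp x).integrable one_le_two) ((h.memLp y).integrable one_le_two),
    ← integral_mul_const]
  refine norm_integral_le_of_norm_le ((h.memLp_modulus.integrable one_le_two).mul_const _) ?_
  filter_upwards [h.lipschitz] with s hs using hs x y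

/-- From `‖T s x‖ ≤ ‖T s xs‖ + L s ‖x - xs‖`. No boundedness of the iterates is available, so the
variance must be allowed to grow quadratically; this makes the energy recursion multiplicative. -/
theorem SquareLipschitz.exists_second_moment_le (h : SquareLipschitz Q T L) (xs : Rn n) :
    ∃ κ, 0 ≤ κ ∧ ∀ x, ∫ s, ‖T s x‖ ^ 2 ∂Q ≤ κ * (1 + ‖x - xs‖ ^ 2) := by
  have hi : ∀ x, Integrable (fun s => ‖T s x‖ ^ 2) Q := fun x => (h.memLp x).integrable_norm_pow'
  have hL : Integrable (fun s => L s ^ 2) Q := h.memLp_modulus.integrable_sq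
  have h0 : 0 ≤ ∫ s, ‖T s xs‖ ^ 2 ∂Q := integral_nonneg fun _ => sq_nonneg _
  have h1 : 0 ≤ ∫ s, L s ^ 2 ∂Q := integral_nonneg fun _ => sq_nonneg _
  refine ⟨2 * (∫ s, ‖T s xs‖ ^ 2 ∂Q) + 2 * ∫ s, L s ^ 2 ∂Q, by positivity, fun x => ?_⟩
  have h2 : ∫ s, ‖T s x‖ ^ 2 ∂Q ≤ ∫ s, (2 * ‖T s xs‖ ^ 2 + 2 * ‖x - xs‖ ^ 2 * L s ^ 2) ∂Q := by
    refine integral_mono_ae (hi x) (((hi xs).const_mul 2).add (hL.const_mul _)) ?_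
    filter_upwards [h.lipschitz, h.one_le] with s hs hs1
    have h3 := norm_le_of_lipschitz hs x xs
    have h4 := pow_le_pow_left₀ (norm_nonneg _) h3 2
    nlinarith [sq_nonneg (‖T s xs‖ - L s * ‖x - xs‖)]
  rw [integral_add ((hi xs).const_mul 2) (hL.const_mul _), integral_const_mul,
    integral_const_mul] at h2
  have := mul_nonneg h0 (sq_nonneg ‖x - xs‖)
  linarith

end Oracle

/-! ### Measurability of the algorithm -/

theorem measurable_nat_sInf {α : Type*} [MeasurableSpace α] {q : α → ℕ → Prop}
    (hq : ∀ k, MeasurableSet {x | q x k}) : Measurable fun x => sInf {k | q x k} := by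
  refine measurable_to_countable' fun k => ?_
  have hlt : ∀ k, MeasurableSet {x | ∀ j < k, ¬ q x j} := fun k => by
    simp only [Set.ofPred_forall]
    exact MeasurableSet.iInter fun j => MeasurableSet.iInter fun _ => (hq j).compl
  have hall : MeasurableSet {x | ∀ j, ¬ q x j} := by
    simp only [Set.ofPred_forall]
    exact MeasurableSet.iInter fun j => (hq j).compl
  -- The infimum of the empty set is `0`, so the points where no index works belong to the fibre
  -- over `0`.
  have e : (fun x => sInf {k | q x k}) ⁻¹' {k}
      = ({x | q x k} ∩ {x | ∀ j < k, ¬ q x j}) ∪ (if k = 0 then {x | ∀ j, ¬ q x j} else ∅) := by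
    ext x
    simp only [Set.mem_preimage, Set.mem_singleton_iff, Set.mem_union, Set.mem_inter_iff,
      Set.mem_ofPred_eq]
    constructor
    · intro h
      rcases Set.eq_empty_or_nonempty {k | q x k} with he | hne
      · right
        rw [he, Nat.sInf_empty] at h
        rw [if_pos h.symm]
        intro j hj
        exact (Set.mem_empty_iff_false j).1 (he ▸ hj : j ∈ (∅ : Set ℕ))
      · left
        subst h
        exact ⟨Nat.sInf_mem hne, fun j hj => Nat.notMem_of_lt_sInf hj⟩
    · rintro (⟨h1, h2⟩ | h)
      · exact le_antisymm (Nat.sInf_le h1)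
          (le_csInf ⟨k, h1⟩ fun j hj => not_lt.1 fun hjk => h2 j hjk hj)
      · split_ifs at h with hk
        · have he : {k | q x k} = ∅ := Set.eq_empty_iff_forall_notMem.2 h
          rw [he, Nat.sInf_empty, hk]
        · exact h.elim
  rw [e]
  refine ((hq k).inter (hlt k)).union ?_
  split_ifs
  exacts [hall, MeasurableSet.empty]

section Measurability

variable {n : ℕ} {X : Set (Rn n)} {α : Type*} [MeasurableSpace α]

theorem measurable_stepSize (hP : Measurable (proj X)) (p : Params)
    {G : α → Rn n → Rn n} (hG : Measurable (Function.uncurry G)) {x : α → Rn n}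
    (hx : Measurable x) : Measurable fun a => stepSize X p (G a) (x a) := by
  have hGx : ∀ {y : α → Rn n}, Measurable y → Measurable fun a => G a (y a) := fun hy =>
    hG.comp (measurable_id.prodMk hy)
  unfold stepSize
  have h : Measurable fun a =>
      sInf {m : ℕ | LineSearchTest X p.μ (G a) (x a) (p.γ * p.ρ ^ m)} := by
    refine measurable_nat_sInf fun m => ?_
    unfold LineSearchTest
    have hy : Measurable fun a => proj X (x a - (p.γ * p.ρ ^ m) • G a (x a)) :=
      hP.comp (hx.sub ((hGx hx).fun_const_smul _))
    exact measurableSet_le (((hGx hx).sub (hGx hy)).norm.const_mul _)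
      ((hx.sub hy).norm.const_mul _)
  exact (measurable_from_nat (f := fun m => p.γ * p.ρ ^ m)).comp h

theorem measurable_proj_stepSize (hP : Measurable (proj X)) (p : Params)
    {G : α → Rn n → Rn n} (hG : Measurable (Function.uncurry G)) {x : α → Rn n}
    (hx : Measurable x) :
    Measurable fun a => proj X (x a - stepSize X p (G a) (x a) • G a (x a)) :=
  hP.comp (hx.sub ((measurable_stepSize hP p hG hx).smul (hG.comp (measurable_id.prodMk hx))))

open Classical in
theorem measurable_step (hP : Measurable (proj X)) (p : Params)
    {G K : α → Rn n → Rn n} (hG : Measurable (Function.uncurry G))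
    (hK : Measurable (Function.uncurry K)) {s : α → Rn n × ℕ} (hs : Measurable s) :
    Measurable fun a => step X p (G a) (K a) (s a) := by
  have hx : Measurable fun a => (s a).1 := measurable_fst.comp hs
  have hθ : Measurable fun a => (s a).2 := measurable_snd.comp hs
  have hGx : Measurable fun a => G a (s a).1 := hG.comp (measurable_id.prodMk hx)
  have ht := measurable_stepSize hP p hG hx
  have hy := measurable_proj_stepSize hP p hG hx
  have hz : Measurable fun a => proj X ((s a).1 - stepSize X p (G a) (s a).1 •
      K a (proj X ((s a).1 - stepSize X p (G a) (s a).1 • G a (s a).1))) :=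
    hP.comp (hx.sub (ht.smul (hK.comp (measurable_id.prodMk hy))))
  have hpow : Measurable fun a => p.ν * ((s a).2 : ℝ) ^ (-p.τ) :=
    (measurable_from_nat (f := fun m : ℕ => p.ν * (m : ℝ) ^ (-p.τ))).comp hθ
  have hθ1 : Measurable fun a => (s a).2 + 1 := (measurable_from_nat (f := fun m => m + 1)).comp hθ
  have hα : ∀ {u v : α → Rn n} {b : α → ℝ}, Measurable u → Measurable v → Measurable b →
      Measurable fun a => if ‖u a‖ < min ‖v a‖ (b a) then
        inner ℝ (u a) (u a - v a) / ‖u a - v a‖ ^ 2 else p.M + 1 := fun hu hv hb =>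
    Measurable.ite (measurableSet_lt hu.norm (hv.norm.min hb))
      ((hu.inner (hu.sub hv)).div ((hu.sub hv).norm.pow_const 2)) measurable_const
  replace hα := hα (hz.sub hx) (hy.sub hx) hpow
  unfold step
  refine Measurable.ite ?_ (hx.prodMk hθ) ?_
  · exact measurableSet_eq_fun ((hP.comp (hx.sub (hGx.fun_const_smul _))).sub hx) measurable_const
  · refine Measurable.ite (measurableSet_le hα.abs measurable_const)
      (Measurable.prodMk ?_ hθ1) (hz.prodMk hθ)
    exact (hα.smul hx).add ((measurable_const.sub hα).smul hz)

end Measurability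

section State

variable {n : ℕ} {X : Set (Rn n)} {Ξ : Type*} [MeasurableSpace Ξ] {T : Ξ → Rn n → Rn n}

theorem measurable_empOp {α : Type*} [MeasurableSpace α] (hT : Measurable (Function.uncurry T))
    {m : ℕ} {s : α → Fin m → Ξ} (hs : Measurable s) {x : α → Rn n} (hx : Measurable x) :
    Measurable fun a => empOp T (s a) (x a) := by
  unfold empOp
  have h : ∀ j, Measurable fun a => T (s a j) (x a) := fun j =>
    hT.comp (((measurable_pi_apply j).comp hs).prodMk hx)
  exact (Finset.measurable_fun_sum Finset.univ fun j _ => h j).fun_const_smul (m : ℝ)⁻¹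

theorem measurable_uncurry_empOp {α : Type*} [MeasurableSpace α]
    (hT : Measurable (Function.uncurry T)) {m : ℕ} {s : α → Fin m → Ξ} (hs : Measurable s) :
    Measurable (Function.uncurry fun a => empOp T (s a)) :=
  measurable_empOp hT (s := fun q : α × Rn n => s q.1) (hs.comp measurable_fst) measurable_snd

theorem measurable_step_empOp {α : Type*} [MeasurableSpace α] (hP : Measurable (proj X))
    (p : Params) (hT : Measurable (Function.uncurry T)) {m : ℕ} {s t : α → Fin m → Ξ}
    (hs : Measurable s) (ht : Measurable t) {u : α → Rn n × ℕ} (hu : Measurable u) :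
    Measurable fun a => step X p (empOp T (s a)) (empOp T (t a)) (u a) :=
  measurable_step hP p (measurable_uncurry_empOp hT hs) (measurable_uncurry_empOp hT ht) hu

theorem measurable_state (hP : Measurable (proj X)) (p : Params)
    (hT : Measurable (Function.uncurry T)) (S : ℕ → ℕ) (k : ℕ) :
    Measurable fun q : Rn n × ((k : ℕ) → Fin (S k) → Ξ) × ((k : ℕ) → Fin (S k) → Ξ) =>
      state X p T S q.1 q.2.1 q.2.2 k := by
  induction k with
  | zero => exact measurable_fst.prodMk measurable_const
  | succ k ih =>
    have ha : Measurable fun q : Rn n × ((k : ℕ) → Fin (S k) → Ξ) × ((k : ℕ) → Fin (S k) → Ξ) =>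
      q.2.1 k := (measurable_pi_apply k).comp (measurable_fst.comp measurable_snd)
    have hb : Measurable fun q : Rn n × ((k : ℕ) → Fin (S k) → Ξ) × ((k : ℕ) → Fin (S k) → Ξ) =>
      q.2.2 k := (measurable_pi_apply k).comp (measurable_snd.comp measurable_snd)
    exact measurable_step_empOp hP p hT ha hb ih

omit [MeasurableSpace Ξ] in
/-- The state after `k` iterations depends only on the samples of these iterations. -/
theorem state_congr (p : Params) (S : ℕ → ℕ) (x₀ : Rn n) {a b a' b' : (k : ℕ) → Fin (S k) → Ξ}
    (k : ℕ) (ha : ∀ i < k, a i = a' i) (hb : ∀ i < k, b i = b' i) :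
    state X p T S x₀ a b k = state X p T S x₀ a' b' k := by
  induction k with
  | zero => rfl
  | succ k ih =>
    simp only [state]
    rw [ih (fun i hi => ha i (by omega)) fun i hi => hb i (by omega), ha k (by omega),
      hb k (by omega)]

end State

/-! ### Expected decrease of the energy in one iteration -/

/-- The Lyapunov function of the iteration. -/
def energy {n : ℕ} (p : Params) (xs : Rn n) (s : Rn n × ℕ) : ℝ :=
  1 + ‖s.1 - xs‖ ^ 2 + potential p s.2

theorem one_add_norm_sq_le_energy {n : ℕ} (p : Params) (xs : Rn n) (s : Rn n × ℕ) :
    1 + ‖s.1 - xs‖ ^ 2 ≤ energy p xs s :=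
  le_add_of_nonneg_right (potential_nonneg p _)

theorem energy_nonneg {n : ℕ} (p : Params) (xs : Rn n) (s : Rn n × ℕ) : 0 ≤ energy p xs s :=
  (by positivity : 0 ≤ 1 + ‖s.1 - xs‖ ^ 2).trans (one_add_norm_sq_le_energy p xs s)

theorem measurable_energy {n : ℕ} (p : Params) (xs : Rn n) : Measurable (energy p xs) := by
  unfold energy
  exact (measurable_const.add ((measurable_fst.sub measurable_const).norm.pow_const 2)).add
    ((measurable_from_nat (f := potential p)).comp measurable_snd)

section OneStep

variable {n : ℕ} {X : Set (Rn n)} {Ξ : Type*} [MeasurableSpace Ξ] {Q : Measure Ξ}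
  [IsProbabilityMeasure Q] {T : Ξ → Rn n → Rn n} {L : Ξ → ℝ}

theorem SquareLipschitz.ae_empOp_lipschitz (h : SquareLipschitz Q T L) {m : ℕ} (hm : 0 < m) :
    ∀ᵐ a : Fin m → Ξ ∂(Measure.pi fun _ => Q), 0 < (m : ℝ)⁻¹ * ∑ j, L (a j) ∧
      ∀ x y : Rn n, ‖empOp T a x - empOp T a y‖ ≤ ((m : ℝ)⁻¹ * ∑ j, L (a j)) * ‖x - y‖ := by
  have h1 : ∀ᵐ a : Fin m → Ξ ∂(Measure.pi fun _ => Q), ∀ j, 1 ≤ L (a j) ∧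
      ∀ x y : Rn n, ‖T (a j) x - T (a j) y‖ ≤ L (a j) * ‖x - y‖ :=
    ae_all_iff.2 fun j =>
      (Measure.quasiMeasurePreserving_eval (fun _ : Fin m => Q) j).ae (h.one_le.and h.lipschitz)
  filter_upwards [h1] with a ha
  have hm0 : 0 < (m : ℝ)⁻¹ := by positivity
  have : Nonempty (Fin m) := ⟨⟨0, hm⟩⟩
  refine ⟨mul_pos hm0 (Finset.sum_pos (fun j _ => by linarith [(ha j).1])
    Finset.univ_nonempty), fun x y => ?_⟩
  unfold empOp
  rw [← smul_sub, ← Finset.sum_sub_distrib, norm_smul, Real.norm_of_nonneg hm0.le, mul_assoc,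
    Finset.sum_mul]
  exact mul_le_mul_of_nonneg_left ((norm_sum_le _ _).trans
    (Finset.sum_le_sum fun j _ => (ha j).2 x y)) hm0.le

theorem SquareLipschitz.lintegral_empOp_sub_sq_le (h : SquareLipschitz Q T L) {m : ℕ} (hm : 0 < m)
    {xs : Rn n} {κ : ℝ} (hκ : ∀ x, ∫ s, ‖T s x‖ ^ 2 ∂Q ≤ κ * (1 + ‖x - xs‖ ^ 2)) (x : Rn n) :
    ∫⁻ a : Fin m → Ξ, ENNReal.ofReal (‖empOp T a x - ∫ s, T s x ∂Q‖ ^ 2)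
      ∂(Measure.pi fun _ => Q) ≤ ENNReal.ofReal (κ * (1 + ‖x - xs‖ ^ 2) * (1 / m)) := by
  refine (lintegral_norm_average_sub_sq_le (h.memLp x) hm).trans (ENNReal.ofReal_le_ofReal ?_)
  rw [mul_one_div]
  exact div_le_div_of_nonneg_right (hκ x) (Nat.cast_nonneg m)

/-- The error of an independent second sample at a point that depends on the first one. -/
theorem SquareLipschitz.lintegral_empOp_sub_sq_half_step_le (h : SquareLipschitz Q T L)
    (hcl : IsClosed X) (hcv : Convex ℝ X) (p : Params) {m : ℕ} (hm : 0 < m) {xs : Rn n}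
    (hxs : xs ∈ X) {κ : ℝ} (hκ0 : 0 ≤ κ)
    (hκ : ∀ x, ∫ s, ‖T s x‖ ^ 2 ∂Q ≤ κ * (1 + ‖x - xs‖ ^ 2)) {B : ℝ} (hB1 : 1 ≤ B)
    (hB : ∀ (G : Rn n → Rn n) (x : Rn n) (t : ℝ), 0 ≤ t → t ≤ 1 →
      ‖proj X (x - t • G x) - xs‖ ^ 2 ≤ B * (1 + ‖x - xs‖ ^ 2 + ‖G x - ∫ s, T s x ∂Q‖ ^ 2))
    (hHm : Measurable fun x => ∫ s, T s x ∂Q) (x : Rn n) :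
    ∫⁻ q : (Fin m → Ξ) × (Fin m → Ξ),
        ENNReal.ofReal (‖empOp T q.2 (proj X (x - stepSize X p (empOp T q.1) x • empOp T q.1 x))
          - ∫ s, T s (proj X (x - stepSize X p (empOp T q.1) x • empOp T q.1 x)) ∂Q‖ ^ 2)
        ∂((Measure.pi fun _ => Q).prod (Measure.pi fun _ => Q))
      ≤ ENNReal.ofReal ((2 * κ * B + κ * B * κ) * (1 + ‖x - xs‖ ^ 2) * (1 / m)) := by
  have hP := (continuous_proj ⟨xs, hxs⟩ hcl hcv).measurable
  have hy : Measurable fun a : Fin m → Ξ =>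
      proj X (x - stepSize X p (empOp T a) x • empOp T a x) :=
    measurable_proj_stepSize hP p (measurable_uncurry_empOp h.measurable measurable_id)
      measurable_const
  have hV : Measurable fun a : Fin m → Ξ =>
      ENNReal.ofReal (‖empOp T a x - ∫ s, T s x ∂Q‖ ^ 2) :=
    (((measurable_empOp h.measurable measurable_id measurable_const).sub
      measurable_const).norm.pow_const 2).ennreal_ofReal
  -- Integrating over the second sample first freezes the half step, where the variance bound at a
  -- fixed point applies.
  rw [lintegral_prod]
  swap
  · exact ((((measurable_empOp h.measurable measurable_snd (hy.comp measurable_fst)).sub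
      (hHm.comp (hy.comp measurable_fst))).norm.pow_const 2).ennreal_ofReal).aemeasurable
  have hm1 : 1 / (m : ℝ) ≤ 1 := by
    rw [div_le_one (by positivity)]
    exact_mod_cast hm
  have hm0 : 0 ≤ 1 / (m : ℝ) := by positivity
  set D := 1 + ‖x - xs‖ ^ 2 with hD
  have hD0 : 1 ≤ D := by linarith [sq_nonneg ‖x - xs‖]
  calc _ ≤ ∫⁻ a : Fin m → Ξ, (ENNReal.ofReal (2 * κ * B * D * (1 / m)) + ENNReal.ofReal
          (κ * B * (1 / m)) * ENNReal.ofReal (‖empOp T a x - ∫ s, T s x ∂Q‖ ^ 2))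
          ∂(Measure.pi fun _ => Q) := by
        refine lintegral_mono fun a => ?_
        refine (h.lintegral_empOp_sub_sq_le hm hκ
          (proj X (x - stepSize X p (empOp T a) x • empOp T a x))).trans ?_
        rw [← ENNReal.ofReal_mul (by positivity), ← ENNReal.ofReal_add (by positivity)
          (by positivity)]
        refine ENNReal.ofReal_le_ofReal ?_
        have h1 := hB (empOp T a) x _ (stepSize_pos X p (empOp T a) x).le
          (stepSize_le_one X p (empOp T a) x)
        have h2 : 1 + ‖proj X (x - stepSize X p (empOp T a) x • empOp T a x) - xs‖ ^ 2
            ≤ 2 * B * D + B * ‖empOp T a x - ∫ s, T s x ∂Q‖ ^ 2 := by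
          have : 1 * 1 ≤ B * D := mul_le_mul hB1 hD0 zero_le_one (by linarith)
          rw [← hD] at h1
          linarith
        have h3 := mul_le_mul_of_nonneg_right (mul_le_mul_of_nonneg_left h2 hκ0) hm0
        linarith
    _ = ENNReal.ofReal (2 * κ * B * D * (1 / m)) + ENNReal.ofReal (κ * B * (1 / m)) *
          ∫⁻ a : Fin m → Ξ, ENNReal.ofReal (‖empOp T a x - ∫ s, T s x ∂Q‖ ^ 2)
            ∂(Measure.pi fun _ => Q) := by
        rw [lintegral_add_left measurable_const, lintegral_const_mul _ hV]
        simp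
    _ ≤ ENNReal.ofReal (2 * κ * B * D * (1 / m)) + ENNReal.ofReal (κ * B * (1 / m)) *
          ENNReal.ofReal (κ * D * (1 / m)) := by
        gcongr
        exact h.lintegral_empOp_sub_sq_le hm hκ x
    _ ≤ _ := by
        rw [← ENNReal.ofReal_mul (by positivity), ← ENNReal.ofReal_add (by positivity)
          (by positivity)]
        refine ENNReal.ofReal_le_ofReal ?_
        have h4 : κ * B * κ * D * (1 / m) * (1 / m) ≤ κ * B * κ * D * (1 / m) :=
          mul_le_of_le_one_right (by positivity) hm1
        linarith

/-- The conditional form of the recursion: the state `u` is frozen and the two samples are fresh.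
Lower Lebesgue integrals avoid assuming that the energy of the next state is integrable. -/
theorem exists_lintegral_energy_step_le (h : SquareLipschitz Q T L) (hcl : IsClosed X)
    (hcv : Convex ℝ X) (p : Params) {xs : Rn n} (hxs : xs ∈ X)
    (hsol : ∀ y ∈ X, 0 ≤ inner ℝ (∫ s, T s y ∂Q) (y - xs)) :
    ∃ c C : ℝ, 0 < c ∧ 0 ≤ C ∧ ∀ m : ℕ, 0 < m → ∀ u : Rn n × ℕ,
      ∫⁻ q : (Fin m → Ξ) × (Fin m → Ξ),
          ENNReal.ofReal (energy p xs (step X p (empOp T q.1) (empOp T q.2) u))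
          ∂((Measure.pi fun _ => Q).prod (Measure.pi fun _ => Q))
        + ENNReal.ofReal (c * residual X (fun x => ∫ s, T s x ∂Q) p.γ u.1 ^ 2)
      ≤ ENNReal.ofReal ((1 + C * (1 / √m)) * energy p xs u) := by
  have hne : X.Nonempty := ⟨xs, hxs⟩
  have hP := (continuous_proj hne hcl hcv).measurable
  have hl := h.one_le_integral
  have hH := h.norm_integral_sub_le
  obtain ⟨κ, hκ0, hκ⟩ := h.exists_second_moment_le xs
  obtain ⟨m₀, c, A, hc, hA, hstep⟩ := exists_step_le hcl hcv p hxs hl hH hsol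
  have hHm : Measurable fun x => ∫ s, T s x ∂Q :=
    (LipschitzWith.of_dist_le_mul (K := ⟨∫ s, L s ∂Q, by linarith⟩) fun x y => by
      rw [dist_eq_norm, dist_eq_norm]
      exact hH x y).continuous.measurable
  set l := ∫ s, L s ∂Q with hldef
  set H : Rn n → Rn n := fun x => ∫ s, T s x ∂Q with hHdef
  set B := 3 * (1 + ‖H xs‖ + l) ^ 2 with hBdef
  have hB1 : 1 ≤ B := by
    have : 1 ≤ (1 + ‖H xs‖ + l) ^ 2 := one_le_pow₀ (by linarith [norm_nonneg (H xs)])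
    linarith
  have hB : ∀ (G : Rn n → Rn n) (x : Rn n) (t : ℝ), 0 ≤ t → t ≤ 1 →
      ‖proj X (x - t • G x) - xs‖ ^ 2 ≤ B * (1 + ‖x - xs‖ ^ 2 + ‖G x - H x‖ ^ 2) :=
    fun G x t ht0 ht1 => norm_proj_step_sub_sq_le hcl hcv hxs (by linarith) hH x ht0 ht1
  set L2 := ∫ s, L s ^ 2 ∂Q with hL2
  have hL20 : 0 ≤ L2 := integral_nonneg fun _ => sq_nonneg _
  -- One summand for each error: the Lipschitz constant, the first sample at `x`, the first sample
  -- at the `m₀ + 1` reference points, the second sample at the half step, and the remainder of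
  -- Young's inequality.
  set C := A * (L2 + κ + (m₀ + 1) * (2 * κ * B) + (2 * κ * B + κ * B * κ) + 1) with hC
  refine ⟨c, C, hc, by positivity, fun m hm u => ?_⟩
  obtain ⟨x, θ⟩ := u
  set D := 1 + ‖x - xs‖ ^ 2 with hD
  have hD1 : 1 ≤ D := by linarith [sq_nonneg ‖x - xs‖]
  have hm0 : (0 : ℝ) < m := by exact_mod_cast hm
  -- This weight equalizes `w * (1 / m)` and `1 / w`.
  set w := √(m : ℝ) with hw
  have hw1 : 1 ≤ w := by
    rw [hw, Real.one_le_sqrt]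
    exact_mod_cast hm
  have hw0 : 0 < w := by linarith
  have hww : w * w = m := Real.mul_self_sqrt hm0.le
  have hmw : 1 / (m : ℝ) ≤ 1 / w := one_div_le_one_div_of_le hw0 (by nlinarith)
  have hwm : w * (1 / m) = 1 / w := by
    rw [← hww]
    field_simp
  set π := (Measure.pi fun _ : Fin m => Q) with hπ
  set y : (Fin m → Ξ) → Rn n := fun a => proj X (x - stepSize X p (empOp T a) x • empOp T a x)
    with hy
  set f₁ : (Fin m → Ξ) → ENNReal := fun a =>
    ENNReal.ofReal (D * ((m : ℝ)⁻¹ * ∑ j, L (a j) - l) ^ 2) with hf₁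
  set f₂ : Rn n → (Fin m → Ξ) → ENNReal := fun v a =>
    ENNReal.ofReal (‖empOp T a v - H v‖ ^ 2) with hf₂
  set f₄ : (Fin m → Ξ) × (Fin m → Ξ) → ENNReal := fun q =>
    ENNReal.ofReal (‖empOp T q.2 (y q.1) - H (y q.1)‖ ^ 2) with hf₄
  set v : ℕ → Rn n := fun i => proj X (x - (p.γ * p.ρ ^ i) • H x) with hv
  have hf₁m : AEMeasurable f₁ π :=
    ((integrable_average_sub_sq h.memLp_modulus l).aestronglyMeasurable.aemeasurable.const_mul
      D).ennreal_ofReal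
  have hf₂m : ∀ v, Measurable (f₂ v) := fun v =>
    (((measurable_empOp h.measurable measurable_id measurable_const).sub
      measurable_const).norm.pow_const 2).ennreal_ofReal
  have hf₂c : ∀ v, Measurable fun q : (Fin m → Ξ) × (Fin m → Ξ) => f₂ v q.1 := fun v =>
    (hf₂m v).comp measurable_fst
  have hym : Measurable y := measurable_proj_stepSize hP p
    (measurable_uncurry_empOp h.measurable measurable_id) measurable_const
  have hf₄m : Measurable f₄ := ((((measurable_empOp h.measurable measurable_snd
    (hym.comp measurable_fst)).sub (hHm.comp (hym.comp
      measurable_fst))).norm.pow_const 2).ennreal_ofReal)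
  have hi₁ : ∫⁻ a, f₁ a ∂π ≤ ENNReal.ofReal (L2 * D * (1 / w)) := by
    simp only [hf₁, ENNReal.ofReal_mul (by linarith : 0 ≤ D)]
    rw [lintegral_const_mul' _ _ ENNReal.ofReal_ne_top]
    refine (mul_le_mul_right (lintegral_average_sub_sq_le h.memLp_modulus hm) _).trans ?_
    rw [← ENNReal.ofReal_mul (by linarith)]
    refine ENNReal.ofReal_le_ofReal ?_
    have := mul_le_mul_of_nonneg_left hmw (by positivity : 0 ≤ L2 * D)
    rw [← hL2, div_eq_mul_one_div]
    linarith
  have hi₂ : ∀ v, ∫⁻ a, f₂ v a ∂π ≤ ENNReal.ofReal (κ * (1 + ‖v - xs‖ ^ 2) * (1 / w)) :=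
    fun v => (h.lintegral_empOp_sub_sq_le hm hκ v).trans
      (ENNReal.ofReal_le_ofReal (mul_le_mul_of_nonneg_left hmw (by positivity)))
  have hi₃ : ∀ i, ∫⁻ a, f₂ (v i) a ∂π ≤ ENNReal.ofReal (2 * κ * B * D * (1 / w)) := by
    intro i
    refine (hi₂ _).trans (ENNReal.ofReal_le_ofReal
      (mul_le_mul_of_nonneg_right ?_ (by positivity)))
    have h1 := hB H x (p.γ * p.ρ ^ i) (mul_nonneg p.γ_pos.le (pow_nonneg p.ρ_pos.le _))
      (mul_le_one₀ p.γ_le_one (pow_nonneg p.ρ_pos.le _) (pow_le_one₀ p.ρ_pos.le p.ρ_lt_one.le))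
    rw [sub_self, norm_zero, ← hD] at h1
    have h2 : 1 * 1 ≤ B * D := mul_le_mul hB1 hD1 zero_le_one (by linarith)
    have h3 : 1 + ‖v i - xs‖ ^ 2 ≤ 2 * B * D := by
      simp only [hv]
      linarith
    have := mul_le_mul_of_nonneg_left h3 hκ0
    linarith
  have hi₄ : ENNReal.ofReal w * ∫⁻ q, f₄ q ∂(π.prod π)
      ≤ ENNReal.ofReal ((2 * κ * B + κ * B * κ) * D * (1 / w)) := by
    refine (mul_le_mul_right (h.lintegral_empOp_sub_sq_half_step_le hcl hcv p hm hxs hκ0 hκ hB1 hB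
      hHm x) _).trans ?_
    rw [← ENNReal.ofReal_mul hw0.le]
    refine ENNReal.ofReal_le_ofReal (le_of_eq ?_)
    rw [← hwm]
    ring
  have hpt : ∀ᵐ q ∂(π.prod π),
      ENNReal.ofReal (energy p xs (step X p (empOp T q.1) (empOp T q.2) (x, θ)))
        + ENNReal.ofReal (c * residual X H p.γ x ^ 2)
      ≤ ENNReal.ofReal (energy p xs (x, θ)) + ENNReal.ofReal A *
        (f₁ q.1 + f₂ x q.1 + ∑ i ∈ Finset.range (m₀ + 1), f₂ (v i) q.1
          + ENNReal.ofReal w * f₄ q + ENNReal.ofReal (D * (1 / w))) := by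
    filter_upwards [Measure.quasiMeasurePreserving_fst.ae (h.ae_empOp_lipschitz hm)] with q hq
    have h1 := hstep (empOp T q.1) (empOp T q.2) _ w x θ hq.1 hq.2 hw1
    rw [← ENNReal.ofReal_add (energy_nonneg _ _ _) (by positivity)]
    simp only [hf₁, hf₂, hf₄]
    rw [← ENNReal.ofReal_mul hw0.le, ← ENNReal.ofReal_sum_of_nonneg fun _ _ => sq_nonneg _,
      ← ENNReal.ofReal_add (by positivity) (by positivity),
      ← ENNReal.ofReal_add (by positivity) (Finset.sum_nonneg fun _ _ => sq_nonneg _),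
      ← ENNReal.ofReal_add (by positivity) (by positivity),
      ← ENNReal.ofReal_add (by positivity) (by positivity),
      ← ENNReal.ofReal_mul hA.le,
      ← ENNReal.ofReal_add (energy_nonneg _ _ _) (by positivity)]
    refine ENNReal.ofReal_le_ofReal ?_
    unfold energy
    rw [mul_one_div]
    simp only [hv, hy, hD] at h1 ⊢
    linarith
  have hprod : ∀ {f : (Fin m → Ξ) → ENNReal}, AEMeasurable f π →
      ∫⁻ q, f q.1 ∂(π.prod π) = ∫⁻ a, f a ∂π := fun hf => by
    rw [lintegral_prod _ hf.comp_fst]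
    simp
  calc _ = ∫⁻ q, (ENNReal.ofReal (energy p xs (step X p (empOp T q.1) (empOp T q.2) (x, θ)))
        + ENNReal.ofReal (c * residual X H p.γ x ^ 2)) ∂(π.prod π) := by
        rw [lintegral_add_right _ measurable_const]
        simp
    _ ≤ _ := lintegral_mono_ae hpt
    _ = ENNReal.ofReal (energy p xs (x, θ)) + ENNReal.ofReal A *
        (∫⁻ a, f₁ a ∂π + ∫⁻ a, f₂ x a ∂π + ∑ i ∈ Finset.range (m₀ + 1), ∫⁻ a, f₂ (v i) a ∂π
          + ENNReal.ofReal w * ∫⁻ q, f₄ q ∂(π.prod π) + ENNReal.ofReal (D * (1 / w))) := by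
        rw [lintegral_add_left measurable_const, lintegral_const_mul' _ _ ENNReal.ofReal_ne_top,
          lintegral_add_right _ measurable_const,
          lintegral_add_right _ (hf₄m.const_mul _),
          lintegral_add_right _ (Finset.measurable_fun_sum _ fun i _ => hf₂c (v i)),
          lintegral_add_right _ (hf₂c x),
          lintegral_finsetSum _ fun i _ => hf₂c (v i),
          lintegral_const_mul _ hf₄m, hprod hf₁m, hprod (hf₂m x).aemeasurable]
        simp only [fun i => hprod (hf₂m (v i)).aemeasurable]
        simp
    _ ≤ ENNReal.ofReal (energy p xs (x, θ)) + ENNReal.ofReal A *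
        (ENNReal.ofReal (L2 * D * (1 / w)) + ENNReal.ofReal (κ * D * (1 / w))
          + ∑ i ∈ Finset.range (m₀ + 1), ENNReal.ofReal (2 * κ * B * D * (1 / w))
          + ENNReal.ofReal ((2 * κ * B + κ * B * κ) * D * (1 / w))
          + ENNReal.ofReal (D * (1 / w))) := by
        gcongr with i
        · exact hi₂ x
        · exact hi₃ i
    _ ≤ _ := by
        rw [← ENNReal.ofReal_sum_of_nonneg fun _ _ => by positivity,
          ← ENNReal.ofReal_add (by positivity) (by positivity),
          ← ENNReal.ofReal_add (by positivity) (Finset.sum_nonneg fun _ _ => by positivity),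
          ← ENNReal.ofReal_add (by positivity) (by positivity),
          ← ENNReal.ofReal_add (by positivity) (by positivity),
          ← ENNReal.ofReal_mul hA.le,
          ← ENNReal.ofReal_add (energy_nonneg _ _ _) (by positivity)]
        refine ENNReal.ofReal_le_ofReal ?_
        have h1 : D ≤ energy p xs (x, θ) := one_add_norm_sq_le_energy p xs (x, θ)
        have h2 := mul_le_mul_of_nonneg_left h1 (by positivity : 0 ≤ C * (1 / w))
        rw [Finset.sum_const, Finset.card_range, nsmul_eq_mul]
        push_cast
        rw [hC] at h2 ⊢
        linarith

end OneStep

/-! ### Independence of the state from the current samples -/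

section Independence

variable {Ω : Type*} [MeasurableSpace Ω] {P : Measure Ω}

/-- Associativity of product measures: both groupings say that the joint law is the product of the
three marginals. -/
theorem indepFun_prodMk_left_of_indepFun [IsProbabilityMeasure P] {α β γ : Type*} [MeasurableSpace α] [MeasurableSpace β]
    [MeasurableSpace γ] {f : Ω → α} {g : Ω → β} {h : Ω → γ} (hf : Measurable f)
    (hg : Measurable g) (hh : Measurable h) (hfgh : IndepFun f (fun ω => (g ω, h ω)) P)
    (hgh : IndepFun g h P) : IndepFun (fun ω => (f ω, g ω)) h P := by
  have hfg : IndepFun f g P := hfgh.comp measurable_id measurable_fst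
  have := Measure.isProbabilityMeasure_map (μ := P) hf.aemeasurable
  have := Measure.isProbabilityMeasure_map (μ := P) hg.aemeasurable
  have := Measure.isProbabilityMeasure_map (μ := P) hh.aemeasurable
  rw [indepFun_iff_map_prod_eq_prod_map_map (hf.prodMk hg).aemeasurable hh.aemeasurable,
    hfg.map_prod_eq_prod_map_map hf.aemeasurable hg.aemeasurable]
  have h1 := hfgh.map_prod_eq_prod_map_map hf.aemeasurable (hg.prodMk hh).aemeasurable
  rw [hgh.map_prod_eq_prod_map_map hg.aemeasurable hh.aemeasurable] at h1
  have h2 := (measurePreserving_prodAssoc (P.map f) (P.map g) (P.map h)).symm.map_eq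
  rw [← h2, ← h1, Measure.map_map (MeasurableEquiv.measurable _)
    (hf.prodMk (hg.prodMk hh))]
  rfl

theorem indepFun_of_measurable_iSup {ι Ξ α β : Type*} [MeasurableSpace Ξ] [mα : MeasurableSpace α]
    [mβ : MeasurableSpace β] {Z : ι → Ω → Ξ} (hZ : ∀ i, Measurable (Z i)) (hind : iIndepFun Z P)
    {A B : Set ι} (hAB : Disjoint A B) {f : Ω → α} {g : Ω → β}
    (hf : Measurable[⨆ i ∈ A, MeasurableSpace.comap (Z i) inferInstance] f)
    (hg : Measurable[⨆ i ∈ B, MeasurableSpace.comap (Z i) inferInstance] g) :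
    IndepFun f g P := by
  have h := indep_iSup_of_disjoint (m := fun i => MeasurableSpace.comap (Z i) inferInstance)
    (fun i => (hZ i).comap_le) hind hAB
  rw [IndepFun_iff_Indep]
  exact indep_of_indep_of_le_left (indep_of_indep_of_le_right h hg.comap_le) hf.comap_le

omit [MeasurableSpace Ω] in
theorem measurable_iSup_comap {ι Ξ : Type*} [MeasurableSpace Ξ] (Z : ι → Ω → Ξ) {A : Set ι}
    {i : ι} (hi : i ∈ A) : Measurable[⨆ i ∈ A, MeasurableSpace.comap (Z i) inferInstance] (Z i) :=
  (comap_measurable (Z i)).mono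
    (le_iSup₂ (f := fun i (_ : i ∈ A) => MeasurableSpace.comap (Z i) inferInstance) i hi) le_rfl

variable {Ξ : Type*} [MeasurableSpace Ξ] {ξ : Ω → Ξ} {S : ℕ → ℕ}
  {ξs ηs : (k : ℕ) → Fin (S k) → Ω → Ξ}

/-- The common family of all samples. -/
def allSamples (ξs ηs : (k : ℕ) → Fin (S k) → Ω → Ξ)
    (i : (Σ k, Fin (S k)) ⊕ (Σ k, Fin (S k))) : Ω → Ξ :=
  Sum.elim (fun a => ξs a.1 a.2) (fun a => ηs a.1 a.2) i

/-- The samples of the first `k` iterations, the later ones being replaced by a constant. -/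
def truncate (s₀ : Ξ) (k : ℕ) (a : (i : ℕ) → Fin (S i) → Ξ) (i : ℕ) (j : Fin (S i)) : Ξ :=
  if i < k then a i j else s₀

theorem measurable_truncate {α : Type*} [MeasurableSpace α] (s₀ : Ξ) (k : ℕ)
    {a : (i : ℕ) → Fin (S i) → α → Ξ} (ha : ∀ i < k, ∀ j, Measurable (a i j)) :
    Measurable fun ω => truncate s₀ k fun i j => a i j ω := by
  refine measurable_pi_iff.2 fun i => measurable_pi_iff.2 fun j => ?_
  unfold truncate
  split_ifs with h
  · exact ha i h j
  · exact measurable_const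

theorem IsSampling.measurable_allSamples (h : IsSampling P ξ S ξs ηs) (i) :
    Measurable (allSamples ξs ηs i) := by
  rcases i with i | i
  · exact h.measurable_ξs _ _
  · exact h.measurable_ηs _ _

theorem IsSampling.map_ξs [IsProbabilityMeasure P] (h : IsSampling P ξ S ξs ηs) (k : ℕ) :
    P.map (fun ω j => ξs k j ω) = Measure.pi fun _ => P.map ξ := by
  have h0 := h.indep.precomp
    (g := fun j : Fin (S k) => (Sum.inl ⟨k, j⟩ : (Σ k, Fin (S k)) ⊕ (Σ k, Fin (S k))))
    fun i j hij => by simpa using hij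
  have h1 : iIndepFun (fun j => ξs k j) P := h0
  rw [h1.map_fun_eq_pi_map fun j => (h.measurable_ξs k j).aemeasurable]
  simp only [fun j => (h.identDistrib_ξs k j).map_eq]

theorem IsSampling.map_ηs [IsProbabilityMeasure P] (h : IsSampling P ξ S ξs ηs) (k : ℕ) :
    P.map (fun ω j => ηs k j ω) = Measure.pi fun _ => P.map ξ := by
  have h0 := h.indep.precomp
    (g := fun j : Fin (S k) => (Sum.inr ⟨k, j⟩ : (Σ k, Fin (S k)) ⊕ (Σ k, Fin (S k))))
    fun i j hij => by simpa using hij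
  have h1 : iIndepFun (fun j => ηs k j) P := h0
  rw [h1.map_fun_eq_pi_map fun j => (h.measurable_ηs k j).aemeasurable]
  simp only [fun j => (h.identDistrib_ηs k j).map_eq]

theorem IsSampling.map_batch [IsProbabilityMeasure P] (h : IsSampling P ξ S ξs ηs) (k : ℕ) :
    P.map (fun ω => ((fun j => ξs k j ω, fun j => ηs k j ω) : (Fin (S k) → Ξ) × (Fin (S k) → Ξ)))
      = (Measure.pi fun _ => P.map ξ).prod (Measure.pi fun _ => P.map ξ) := by
  have h1 : IndepFun (fun ω j => ξs k j ω) (fun ω j => ηs k j ω) P := by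
    refine indepFun_of_measurable_iSup (Z := allSamples ξs ηs) h.measurable_allSamples h.indep
      (A := Set.range Sum.inl) (B := Set.range Sum.inr) ?_ ?_ ?_
    · rw [Set.disjoint_left]
      rintro _ ⟨a, rfl⟩ ⟨b, hb⟩
      cases hb
    · exact @measurable_pi_lambda _ _ _ (_) _ _ fun j =>
        measurable_iSup_comap (allSamples ξs ηs) (i := Sum.inl ⟨k, j⟩) ⟨_, rfl⟩
    · exact @measurable_pi_lambda _ _ _ (_) _ _ fun j =>
        measurable_iSup_comap (allSamples ξs ηs) (i := Sum.inr ⟨k, j⟩) ⟨_, rfl⟩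
  rw [h1.map_prod_eq_prod_map_map
    (measurable_pi_lambda _ (h.measurable_ξs k)).aemeasurable
    (measurable_pi_lambda _ (h.measurable_ηs k)).aemeasurable, h.map_ξs, h.map_ηs]

/-- The past samples are independent of the current ones. -/
theorem IsSampling.indepFun_past [IsProbabilityMeasure P] (h : IsSampling P ξ S ξs ηs) (s₀ : Ξ) (k : ℕ) :
    IndepFun (fun ω => (truncate s₀ k fun i j => ξs i j ω, truncate s₀ k fun i j => ηs i j ω))
      (fun ω => ((fun j => ξs k j ω, fun j => ηs k j ω) :
        (Fin (S k) → Ξ) × (Fin (S k) → Ξ))) P := by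
  refine indepFun_of_measurable_iSup (Z := allSamples ξs ηs) h.measurable_allSamples h.indep
    (A := {i | Sum.elim (fun a => a.1) (fun a => a.1) i < k})
    (B := {i | Sum.elim (fun a => a.1) (fun a => a.1) i = k}) ?_ ?_ ?_
  · rw [Set.disjoint_left]
    intro i hi hi'
    exact absurd hi' (ne_of_lt hi)
  · refine @Measurable.prodMk _ _ _ _ _ (_) _ _ ?_ ?_
    · exact @measurable_truncate _ _ _ _ (_) s₀ k _ fun i hi j =>
        measurable_iSup_comap (allSamples ξs ηs) (i := Sum.inl ⟨i, j⟩) hi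
    · exact @measurable_truncate _ _ _ _ (_) s₀ k _ fun i hi j =>
        measurable_iSup_comap (allSamples ξs ηs) (i := Sum.inr ⟨i, j⟩) hi
  · refine @Measurable.prodMk _ _ _ _ _ (_) _ _ ?_ ?_
    · exact @measurable_pi_lambda _ _ _ (_) _ _ fun j =>
        measurable_iSup_comap (allSamples ξs ηs) (i := Sum.inl ⟨k, j⟩) rfl
    · exact @measurable_pi_lambda _ _ _ (_) _ _ fun j =>
        measurable_iSup_comap (allSamples ξs ηs) (i := Sum.inr ⟨k, j⟩) rfl

/-- The state before an iteration is independent of the samples of this iteration. -/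
theorem IsSampling.indepFun_state [IsProbabilityMeasure P] {n : ℕ} {X : Set (Rn n)} {T : Ξ → Rn n → Rn n}
    (h : IsSampling P ξ S ξs ηs) (hP : Measurable (proj X)) (p : Params)
    (hT : Measurable (Function.uncurry T)) {x₀ : Ω → Rn n} (hx₀ : Measurable x₀)
    (hind : IndepFun x₀
      (fun ω => ((fun k j => ξs k j ω, fun k j => ηs k j ω) :
        ((k : ℕ) → Fin (S k) → Ξ) × ((k : ℕ) → Fin (S k) → Ξ))) P) (k : ℕ) :
    IndepFun (fun ω => state X p T S (x₀ ω) (fun i j => ξs i j ω) (fun i j => ηs i j ω) k)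
      (fun ω => ((fun j => ξs k j ω, fun j => ηs k j ω) :
        (Fin (S k) → Ξ) × (Fin (S k) → Ξ))) P := by
  -- Truncation needs some default sample; a probability space has a point, and any value of `ξ`
  -- will do.
  obtain ⟨ω₀⟩ := P.nonempty_of_neZero
  set s₀ := ξ ω₀
  have htr : Measurable fun a : (i : ℕ) → Fin (S i) → Ξ => truncate s₀ k a :=
    measurable_truncate s₀ k (a := fun i j (a : (i : ℕ) → Fin (S i) → Ξ) => a i j) fun i _ j =>
      (measurable_pi_apply j).comp (measurable_pi_apply i)
  have hξs : Measurable fun ω => ((fun k j => ξs k j ω) : (k : ℕ) → Fin (S k) → Ξ) :=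
    measurable_pi_lambda _ fun i => measurable_pi_lambda _ fun j => h.measurable_ξs i j
  have hηs : Measurable fun ω => ((fun k j => ηs k j ω) : (k : ℕ) → Fin (S k) → Ξ) :=
    measurable_pi_lambda _ fun i => measurable_pi_lambda _ fun j => h.measurable_ηs i j
  have hev : Measurable fun a : (i : ℕ) → Fin (S i) → Ξ => a k := measurable_pi_apply k
  -- The initial point is independent of past and current samples jointly, and the past is
  -- independent of the present; regrouping makes (initial point, past) independent of the present.
  have h1 := hind.comp (φ := id)
    (ψ := fun q : ((k : ℕ) → Fin (S k) → Ξ) × ((k : ℕ) → Fin (S k) → Ξ) =>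
      ((truncate s₀ k q.1, truncate s₀ k q.2), (q.1 k, q.2 k))) measurable_id
    (((htr.comp measurable_fst).prodMk (htr.comp measurable_snd)).prodMk
      ((hev.comp measurable_fst).prodMk (hev.comp measurable_snd)))
  have h2 := indepFun_prodMk_left_of_indepFun hx₀ ((htr.comp hξs).prodMk (htr.comp hηs))
    ((measurable_pi_lambda _ (h.measurable_ξs k)).prodMk
      (measurable_pi_lambda _ (h.measurable_ηs k))) h1 (h.indepFun_past s₀ k)
  have h3 := h2.comp (measurable_state hP p hT S k) measurable_id
  convert h3 using 1
  · ext1 ω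
    refine state_congr p S (x₀ ω) k (fun i hi => ?_) fun i hi => ?_
    · ext j
      simp [truncate, hi]
    · ext j
      simp [truncate, hi]
  · rfl

end Independence

/-! ### Summation of the recursion -/

/-- A discrete Gronwall argument: quasi-monotone sequences have summable decrements. -/
theorem exists_sum_le_of_add_le {u r s : ℕ → ℝ} (hu : ∀ k, 0 ≤ u k) (hr : ∀ k, 0 ≤ r k)
    (hs0 : ∀ k, 0 ≤ s k) (hs : Summable s) (h : ∀ k, u (k + 1) + r k ≤ (1 + s k) * u k) :
    ∃ K, ∀ N, ∑ k ∈ Finset.range N, r k ≤ K := by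
  have hsum : ∀ N, ∑ k ∈ Finset.range N, s k ≤ ∑' k, s k := fun N =>
    hs.sum_le_tsum _ fun k _ => hs0 k
  have h1 : ∀ k, u k ≤ u 0 * Real.exp (∑ i ∈ Finset.range k, s i) := by
    intro k
    induction k with
    | zero => simp
    | succ k ih =>
      rw [Finset.sum_range_succ, Real.exp_add, ← mul_assoc]
      have h2 := Real.add_one_le_exp (s k)
      calc u (k + 1) ≤ (1 + s k) * u k := by linarith [h k, hr k]
        _ ≤ Real.exp (s k) * (u 0 * Real.exp (∑ i ∈ Finset.range k, s i)) :=
          mul_le_mul (by linarith) ih (hu k) (Real.exp_pos _).le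
        _ = _ := mul_comm _ _
  set U := u 0 * Real.exp (∑' k, s k) with hU
  have h2 : ∀ k, u k ≤ U := fun k => (h1 k).trans
    (mul_le_mul_of_nonneg_left (Real.exp_le_exp.2 (hsum k)) (hu 0))
  have hU0 : 0 ≤ U := (hu 0).trans (h2 0)
  -- With `u` bounded by `U`, the factor `1 + s k` becomes the additive error `U * s k`, and the
  -- recursion telescopes.
  have h3 : ∀ N, u N + ∑ k ∈ Finset.range N, r k ≤ u 0 + U * ∑ k ∈ Finset.range N, s k := by
    intro N
    induction N with
    | zero => simp
    | succ N ih =>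
      rw [Finset.sum_range_succ, Finset.sum_range_succ]
      have := mul_le_mul_of_nonneg_left (h2 N) (hs0 N)
      linarith [h N]
  refine ⟨u 0 + U * ∑' k, s k, fun N => ?_⟩
  have := mul_le_mul_of_nonneg_left (hsum N) hU0
  linarith [h3 N, hu N]

theorem inf'_range_le_of_sum_le {f : ℕ → ℝ} {K : ℝ} (N : ℕ) (hN : 1 ≤ N) (hK : 0 ≤ K)
    (h : ∑ k ∈ Finset.range (N + 1), f k ≤ K) :
    (Finset.range (N + 1)).inf' Finset.nonempty_range_add_one f ≤ K * (1 / (N : ℝ)) := by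
  have h1 := Finset.card_nsmul_le_sum (Finset.range (N + 1)) f
    ((Finset.range (N + 1)).inf' Finset.nonempty_range_add_one f) fun k hk => Finset.inf'_le f hk
  rw [Finset.card_range, nsmul_eq_mul, Nat.cast_add, Nat.cast_one] at h1
  have hN0 : (0 : ℝ) < N := by exact_mod_cast hN
  rw [mul_one_div, le_div_iff₀ hN0]
  -- No sign is assumed for `f`: passing from `N + 1` to `N` uses a nonnegative minimum, and a
  -- negative minimum makes the bound trivial.
  rcases le_or_gt 0 ((Finset.range (N + 1)).inf' Finset.nonempty_range_add_one f) with h2 | h2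
  · linarith
  · nlinarith

end AndersonSEG

end

/-! ### The convergence rate -/

theorem mainTheorem2 {n : ℕ} {Ω Ξ : Type*} [MeasurableSpace Ω] [MeasurableSpace Ξ]
    (P : Measure Ω) [IsProbabilityMeasure P]
    (X : Set (AndersonSEG.Rn n)) (hXclosed : IsClosed X) (hXconvex : Convex ℝ X)
    (T : Ξ → AndersonSEG.Rn n → AndersonSEG.Rn n) (hT : Measurable (Function.uncurry T))
    (ξ : Ω → Ξ) (hξ : Measurable ξ)
    (hSOL : (AndersonSEG.SOL X (AndersonSEG.meanOp P ξ T)).Nonempty)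
    (hpseudo : AndersonSEG.PseudomonotoneOn (AndersonSEG.meanOp P ξ T) X)
    (horacle : AndersonSEG.OracleAssumption P ξ T)
    (S : ℕ → ℕ) (hSpos : ∀ k, 0 < S k)
    (hSsum : Summable fun k => 1 / √(S k : ℝ))
    (ξs ηs : (k : ℕ) → Fin (S k) → Ω → Ξ)
    (hsampling : AndersonSEG.IsSampling P ξ S ξs ηs)
    (p : AndersonSEG.Params)
    (x₀ : Ω → AndersonSEG.Rn n) (hx₀meas : Measurable x₀) (hx₀mem : ∀ ω, x₀ ω ∈ X)
    (hx₀sq : MemLp x₀ 2 P)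
    (hx₀indep : IndepFun x₀
      (fun ω => ((fun k j => ξs k j ω, fun k j => ηs k j ω) :
        ((k : ℕ) → Fin (S k) → Ξ) × ((k : ℕ) → Fin (S k) → Ξ))) P) :
    (∀ k, Integrable (fun ω =>
      AndersonSEG.residual X (AndersonSEG.meanOp P ξ T) p.γ
        (AndersonSEG.iterate X p T S x₀ ξs ηs k ω) ^ 2) P) ∧
    ∃ C : ℝ, 0 < C ∧ ∀ N : ℕ, 1 ≤ N →
      (Finset.range (N + 1)).inf' Finset.nonempty_range_add_one (fun k =>
        ∫ ω, AndersonSEG.residual X (AndersonSEG.meanOp P ξ T) p.γ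
          (AndersonSEG.iterate X p T S x₀ ξs ηs k ω) ^ 2 ∂P) ≤ C * (1 / (N : ℝ)) := by
  obtain ⟨xs, hxs, hsol⟩ := hSOL
  obtain ⟨L, hL⟩ := horacle.exists_squareLipschitz hξ hT
  have := Measure.isProbabilityMeasure_map (μ := P) hξ.aemeasurable
  have hP := (AndersonSEG.continuous_proj ⟨xs, hxs⟩ hXclosed hXconvex).measurable
  have hmean : AndersonSEG.meanOp P ξ T = fun x => ∫ s, T s x ∂(P.map ξ) := by
    ext1 x
    exact (integral_map hξ.aemeasurable
      (AndersonSEG.measurable_section hT x).aestronglyMeasurable).symm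
  have hsol' : ∀ y ∈ X, 0 ≤ inner ℝ (∫ s, T s y ∂(P.map ξ)) (y - xs) := fun y hy => by
    have := hpseudo xs hxs y hy (hsol y hy)
    rwa [hmean] at this
  obtain ⟨c, C, hc, hC, hstep⟩ :=
    AndersonSEG.exists_lintegral_energy_step_le hL hXclosed hXconvex p hxs hsol'
  rw [hmean]
  have hHcont : Continuous fun x => ∫ s, T s x ∂(P.map ξ) :=
    (LipschitzWith.of_dist_le_mul (K := ⟨∫ s, L s ∂(P.map ξ), by linarith [hL.one_le_integral]⟩)
      fun x y => by
        rw [dist_eq_norm, dist_eq_norm]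
        exact hL.norm_integral_sub_le x y).continuous
  set H : AndersonSEG.Rn n → AndersonSEG.Rn n := fun x => ∫ s, T s x ∂(P.map ξ)
  have hrm : Measurable fun x => AndersonSEG.residual X H p.γ x ^ 2 :=
    ((hP.comp (measurable_id.sub (hHcont.measurable.fun_const_smul p.γ))).sub
      measurable_id).norm.pow_const 2
  set st : ℕ → Ω → AndersonSEG.Rn n × ℕ := fun k ω =>
    AndersonSEG.state X p T S (x₀ ω) (fun i j => ξs i j ω) (fun i j => ηs i j ω) k with hst
  have hstm : ∀ k, Measurable (st k) := fun k =>
    (AndersonSEG.measurable_state hP p hT S k).comp (hx₀meas.prodMk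
      ((measurable_pi_lambda _ fun i => measurable_pi_lambda _ fun j =>
        hsampling.measurable_ξs i j).prodMk
      (measurable_pi_lambda _ fun i => measurable_pi_lambda _ fun j =>
        hsampling.measurable_ηs i j)))
  have hEm := (AndersonSEG.measurable_energy p xs).ennreal_ofReal
  have hrec : ∀ k, ∫⁻ ω, ENNReal.ofReal (AndersonSEG.energy p xs (st (k + 1) ω)) ∂P
      + ∫⁻ ω, ENNReal.ofReal (c * AndersonSEG.residual X H p.γ (st k ω).1 ^ 2) ∂P
      ≤ ENNReal.ofReal (1 + C * (1 / √(S k : ℝ)))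
        * ∫⁻ ω, ENNReal.ofReal (AndersonSEG.energy p xs (st k ω)) ∂P := by
    intro k
    have hbm : Measurable fun ω => ((fun j => ξs k j ω, fun j => ηs k j ω) :
        (Fin (S k) → Ξ) × (Fin (S k) → Ξ)) :=
      (measurable_pi_lambda _ (hsampling.measurable_ξs k)).prodMk
        (measurable_pi_lambda _ (hsampling.measurable_ηs k))
    -- The joint law of the state and the current samples is a product, so the one-step estimate may
    -- be integrated over the state.
    have hlaw := (hsampling.indepFun_state hP p hT hx₀meas hx₀indep k).map_prod_eq_prod_map_map
      (hstm k).aemeasurable hbm.aemeasurable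
    rw [hsampling.map_batch] at hlaw
    have hstepm : Measurable fun q : (AndersonSEG.Rn n × ℕ) × (Fin (S k) → Ξ) × (Fin (S k) → Ξ) =>
        ENNReal.ofReal (AndersonSEG.energy p xs
          (AndersonSEG.step X p (AndersonSEG.empOp T q.2.1) (AndersonSEG.empOp T q.2.2) q.1)) :=
      hEm.comp (AndersonSEG.measurable_step_empOp hP p hT (measurable_fst.comp measurable_snd)
        (measurable_snd.comp measurable_snd) measurable_fst)
    have hrm' : Measurable fun s : AndersonSEG.Rn n × ℕ =>
        ENNReal.ofReal (c * AndersonSEG.residual X H p.γ s.1 ^ 2) :=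
      ((hrm.comp measurable_fst).const_mul c).ennreal_ofReal
    have e : ∫⁻ ω, ENNReal.ofReal (AndersonSEG.energy p xs (st (k + 1) ω)) ∂P
        = ∫⁻ s, ∫⁻ q : (Fin (S k) → Ξ) × (Fin (S k) → Ξ), ENNReal.ofReal (AndersonSEG.energy p xs
          (AndersonSEG.step X p (AndersonSEG.empOp T q.1) (AndersonSEG.empOp T q.2) s))
          ∂((Measure.pi fun _ : Fin (S k) => P.map ξ).prod (Measure.pi fun _ => P.map ξ))
          ∂(P.map (st k)) := by
      rw [← lintegral_prod _ hstepm.aemeasurable, ← hlaw,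
        lintegral_map hstepm ((hstm k).prodMk hbm)]
      rfl
    rw [e, ← lintegral_map hrm' (hstm k), ← lintegral_add_right _ hrm',
      ← lintegral_map hEm (hstm k), ← lintegral_const_mul _ hEm]
    refine lintegral_mono fun s => ?_
    rw [← ENNReal.ofReal_mul (by positivity)]
    exact hstep (S k) (hSpos k) s
  have hzero : ∫⁻ ω, ENNReal.ofReal (AndersonSEG.energy p xs (st 0 ω)) ∂P ≠ ⊤ := by
    have h1 : Integrable (fun ω => ‖x₀ ω - xs‖ ^ 2) P :=
      (hx₀sq.sub (memLp_const xs)).integrable_norm_pow'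
    have h2 : Integrable (fun ω => AndersonSEG.energy p xs (st 0 ω)) P :=
      ((integrable_const 1).add h1).add (integrable_const (AndersonSEG.potential p 1))
    rw [← ofReal_integral_eq_lintegral_ofReal h2
      (ae_of_all _ fun _ => AndersonSEG.energy_nonneg _ _ _)]
    exact ENNReal.ofReal_ne_top
  -- The recursion itself propagates integrability from the square integrable initial point.
  have hfin : ∀ k, ∫⁻ ω, ENNReal.ofReal (AndersonSEG.energy p xs (st k ω)) ∂P ≠ ⊤ := by
    intro k
    induction k with
    | zero => exact hzero
    | succ k ih =>
      exact ne_top_of_le_ne_top (ENNReal.mul_ne_top ENNReal.ofReal_ne_top ih)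
        (le_self_add.trans (hrec k))
  have hrfin : ∀ k, ∫⁻ ω, ENNReal.ofReal (c * AndersonSEG.residual X H p.γ (st k ω).1 ^ 2) ∂P ≠ ⊤ :=
    fun k => ne_top_of_le_ne_top (ENNReal.mul_ne_top ENNReal.ofReal_ne_top (hfin k))
      (le_add_self.trans (hrec k))
  have hcr : ∀ k, Integrable (fun ω => c * AndersonSEG.residual X H p.γ (st k ω).1 ^ 2) P :=
    fun k => (lintegral_ofReal_ne_top_iff_integrable
      ((hrm.comp (measurable_fst.comp (hstm k))).const_mul c).aestronglyMeasurable
      (ae_of_all _ fun _ => mul_nonneg hc.le (sq_nonneg _))).1 (hrfin k)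
  have hr : ∀ k, Integrable (fun ω => AndersonSEG.residual X H p.γ (st k ω).1 ^ 2) P := fun k => by
    refine ((hcr k).const_mul c⁻¹).congr (ae_of_all _ fun ω => ?_)
    exact inv_mul_cancel_left₀ hc.ne' _
  refine ⟨hr, ?_⟩
  obtain ⟨K, hK⟩ := AndersonSEG.exists_sum_le_of_add_le
    (u := fun k => (∫⁻ ω, ENNReal.ofReal (AndersonSEG.energy p xs (st k ω)) ∂P).toReal)
    (r := fun k => c * ∫ ω, AndersonSEG.residual X H p.γ (st k ω).1 ^ 2 ∂P)
    (s := fun k => C * (1 / √(S k : ℝ))) (fun k => ENNReal.toReal_nonneg)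
    (fun k => mul_nonneg hc.le (integral_nonneg fun _ => sq_nonneg _))
    (fun k => by positivity) (hSsum.mul_left C) fun k => by
      have h1 := ENNReal.toReal_mono
        (ENNReal.mul_ne_top ENNReal.ofReal_ne_top (hfin k)) (hrec k)
      rw [ENNReal.toReal_add (hfin _) (hrfin k), ENNReal.toReal_mul,
        ENNReal.toReal_ofReal (by positivity), ← ofReal_integral_eq_lintegral_ofReal (hcr k)
          (ae_of_all _ fun _ => mul_nonneg hc.le (sq_nonneg _)), integral_const_mul,
        ENNReal.toReal_ofReal (mul_nonneg hc.le (integral_nonneg fun _ => sq_nonneg _))] at h1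
      exact h1
  have hK0 : 0 ≤ K := by simpa using hK 0
  -- Only `K ≥ 0` is known; the added `1` makes the constant positive.
  refine ⟨(K + 1) / c, by positivity, fun N hN => ?_⟩
  refine AndersonSEG.inf'_range_le_of_sum_le N hN (by positivity) ?_
  rw [le_div_iff₀ hc, mul_comm, Finset.mul_sum]
  exact (hK (N + 1)).trans (by linarith)
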